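/- Let $d\in\{2,3\}$, $s\ge 3$ real, $T>0$ and $M\in\mathbb R$. Then there is a constant $C$, depending only on $d,s,T,M$, with the following property. Let $u:[0,T]\times\mathbb R^d\to\mathbb R^d$ and $p$ be a classical solution of the Euler equations $\partial_t u+(u\cdot\nabla)u=-\nabla p$, $\nabla\cdot u=0$, that is $2\pi$-periodic in every space coordinate ($u$ being $C^1$ on $[0,T]\times\mathbb R^d$ and $p(\cdot,t)$ being $C^1$ for each $t$), with $\int_{[0,2\pi]^d}u(x,0)\,dx=0$. Write $u_k(t)=(2\pi)^{-d}\int_{[0,2\pi]^d}u(x,t)e^{-ik\cdot x}dx$ and $\|u\|_{H^s}^2=(2\pi)^d\sum_{k\in\mathbb Z^d}(1+|k|^2)^s|u_k|^2$. Assume that $u(t)\in H^s(\mathbb T^d)$ for $0\le t\le T$ and that $\|u(t)\|_{H^3(\mathbb T^d)}\le M$ for $0\le t\le T$. Let $n\ge 1$ and $m\ge n$ be integers, $F=\{k\in\mathbb Z^d:|k|_\infty\le n\}$, $G=\{k\in\mathbb Z^d:n<|k|_\infty\le m\}$, and $A_k=I-kk^T/|k|^2$ for $k\ne0$. Let $v(x,t)=\sum_{k\in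 F}v_k(t)e^{ik\cdot x}$ be a solution on $[0,T]$ of the $t$-model, that is, $v_k(t)\in\mathbb C^d$, $v_k(0)=u_k(0)$ for $k\in F$, $v_0\equiv0$, and for $0\ne k\in F$ $$\frac{d}{dt}v_k=-i\Big[\sum_{\substack{p+q=k\\p\in F,\,q\in F}}k\cdot v_p\,A_kv_q+\sum_{\substack{p+q=k\\p\in F,\,q\in G}}k\cdot v_p\,A_k\,t\,g_q+\sum_{\substack{p+q=k\\p\in G,\,q\in F}}k\cdot (t\,g_p)\,A_kv_q\Big],\qquad g_q=-i\sum_{\substack{r+r'=q\\r,r'\in F}}q\cdot v_r\,A_qv_{r'}$$ (where $k\cdot z=\sum_jk_jz_j$). Then for all $0\le t\le T$ $$\|u(t)-v(t)\|_{L^2(\mathbb T^d)}\le\frac{C}{n^{s-1}}\,\sup_{0\le\tau\le T}\|u(\tau)\|_{H^s(\mathbb T^d)}.$$ -/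

import Mathlib

open MeasureTheory Set
open scoped ENNReal NNReal

noncomputable section

namespace TModelEuler

/-- Physical space `ℝ^d`; functions on the torus of length `2π` are `2π`-periodic functions
on it. Velocities take values in the same space. -/
abbrev Space (d : ℕ) : Type := EuclideanSpace ℝ (Fin d)

/-- Complex amplitude vectors. -/
abbrev Amp (d : ℕ) : Type := EuclideanSpace ℂ (Fin d)

/-- Wave vectors. -/
abbrev Wave (d : ℕ) : Type := Fin d → ℤ

/-- The period cell `[0, 2π]^d`. -/
def cell (d : ℕ) : Set (Space d) := {x | ∀ i, x i ∈ Icc (0 : ℝ) (2 * Real.pi)}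

/-- `2π`-periodicity in every coordinate. -/
def IsPeriodic {d : ℕ} {α : Type*} (f : Space d → α) : Prop :=
  ∀ x : Space d, ∀ j : Fin d, f (x + EuclideanSpace.single j (2 * Real.pi)) = f x

/-- `k · x`. -/
def phase {d : ℕ} (k : Wave d) (x : Space d) : ℝ := ∑ i, (k i : ℝ) * x i

/-- A real vector, seen as a complex one. -/
def toAmp {d : ℕ} (y : Space d) : Amp d := WithLp.toLp 2 fun i => ((y i : ℝ) : ℂ)

/-- The Fourier coefficient `(2π)^{-d} ∫_{[0,2π]^d} f(x) e^{-i k·x} dx`. -/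
def fourierCoef {d : ℕ} (f : Space d → Space d) (k : Wave d) : Amp d :=
  (((2 * Real.pi) ^ d)⁻¹ : ℝ) •
    ∫ x in cell d, Complex.exp (-(Complex.I * (phase k x : ℂ))) • toAmp (f x)

/-- `|k|²`, the squared Euclidean length. -/
def waveSq {d : ℕ} (k : Wave d) : ℝ := ∑ i, (k i : ℝ) ^ 2

/-- The `L²` norm over the torus of a vector field. -/
def l2Norm {d : ℕ} (f : Space d → Amp d) : ℝ≥0∞ := eLpNorm f 2 (volume.restrict (cell d))

/-- The Sobolev norm `‖f‖_{H^s} = ((2π)^d ∑_k (1+|k|²)^s |f_k|²)^{1/2}`, possibly infinite. -/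
def sobolevNorm {d : ℕ} (s : ℝ) (f : Space d → Space d) : ℝ≥0∞ :=
  (ENNReal.ofReal ((2 * Real.pi) ^ d) *
    ∑' k : Wave d, ENNReal.ofReal ((1 + waveSq k) ^ s) * ‖fourierCoef f k‖ₑ ^ 2) ^ (1 / 2 : ℝ)

/-- Membership in `H^s(𝕋^d)`, for `s ≥ 0`. -/
def MemSobolev {d : ℕ} (s : ℝ) (f : Space d → Space d) : Prop :=
  IsPeriodic f ∧ MemLp f 2 (volume.restrict (cell d)) ∧ sobolevNorm s f < ∞

/-- The divergence `∑_j ∂_j f^j`. -/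
def divergence {d : ℕ} (f : Space d → Space d) (x : Space d) : ℝ :=
  ∑ j, (fderiv ℝ f x (EuclideanSpace.single j 1)) j

/-- `(u, p)` is a classical `2π`-periodic solution on `[0, T]` of the Euler equations
`∂_t u + (u·∇)u = -∇p`, `∇·u = 0`, with `∫ u = 0` initially. At `t = 0` and `t = T` the time
derivative is one-sided; `(u·∇)u` at `x` is the derivative of `u(t)` in the direction `u(t,x)`. -/
structure IsEulerSolution {d : ℕ} (T : ℝ) (u : ℝ → Space d → Space d) (p : ℝ → Space d → ℝ) :
    Prop where
  periodic : ∀ t ∈ Icc 0 T, IsPeriodic (u t)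
  periodic_pressure : ∀ t ∈ Icc 0 T, IsPeriodic (p t)
  contDiffOn : ContDiffOn ℝ 1 (fun z : ℝ × Space d => u z.1 z.2) (Icc 0 T ×ˢ univ)
  contDiff_pressure : ∀ t ∈ Icc 0 T, ContDiff ℝ 1 (p t)
  momentum : ∀ t ∈ Icc 0 T, ∀ x,
    derivWithin (fun τ => u τ x) (Icc 0 T) t + fderiv ℝ (u t) x (u t x) = -gradient (p t) x
  incompressible : ∀ t ∈ Icc 0 T, ∀ x, divergence (u t) x = 0
  mean_zero : ∫ x in cell d, u 0 x = 0

/-- The modes `|k|_∞ ≤ n`. -/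
def modes (d n : ℕ) : Finset (Wave d) :=
  Finset.Icc (fun _ => -(n : ℤ)) (fun _ => (n : ℤ))

/-- The resolved modes are `modes d n`; the unresolved modes are `n < |k|_∞ ≤ m`. -/
def unresolved (d n m : ℕ) : Finset (Wave d) := modes d m \ modes d n

/-- `k · z`, bilinear (no complex conjugation). -/
def waveDot {d : ℕ} (k : Wave d) (z : Amp d) : ℂ := ∑ i, (k i : ℂ) * z i

/-- `A_k z = (I - k kᵀ / |k|²) z`; used for `k ≠ 0` only. -/
def proj {d : ℕ} (k : Wave d) (z : Amp d) : Amp d :=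
  WithLp.toLp 2 fun i => z i - (k i : ℂ) * waveDot k z / (waveSq k : ℂ)

/-- `-i ∑_{p+q=k, p ∈ P, q ∈ Q} (k · a_p) A_k b_q`. -/
def interaction {d : ℕ} (P Q : Finset (Wave d)) (a b : Wave d → Amp d) (k : Wave d) : Amp d :=
  (-Complex.I) • ∑ r ∈ P ×ˢ Q with r.1 + r.2 = k, waveDot k (a r.1) • proj k (b r.2)

/-- Right-hand side at time `t` of the `t`-model with resolved modes `F = {|k|_∞ ≤ n}` and
unresolved modes `G = {n < |k|_∞ ≤ m}`. -/
def tModelField {d : ℕ} (n m : ℕ) (t : ℝ) (a : Wave d → Amp d) (k : Wave d) : Amp d :=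
  let F := modes d n
  let G := unresolved d n m
  let g := fun q => (t : ℂ) • interaction F F a a q
  interaction F F a a k + interaction F G a g k + interaction G F g a k

/-- `v` solves the `t`-model on `[0, T]` with initial amplitudes `a`. Only `v t k` with
`|k|_∞ ≤ n` matter. -/
structure IsTModelSolution {d : ℕ} (n m : ℕ) (T : ℝ) (a : Wave d → Amp d)
    (v : ℝ → Wave d → Amp d) : Prop where
  initial : ∀ k ∈ modes d n, v 0 k = a k
  zero_mode : ∀ t ∈ Icc 0 T, v t 0 = 0
  evolution : ∀ t ∈ Icc 0 T, ∀ k ∈ modes d n, k ≠ 0 →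
    HasDerivWithinAt (fun τ => v τ k) (tModelField n m t (v t) k) (Icc 0 T) t

/-- The trigonometric polynomial `∑_{|k|_∞ ≤ n} a_k e^{i k·x}`. -/
def trigPoly {d : ℕ} (n : ℕ) (a : Wave d → Amp d) (x : Space d) : Amp d :=
  ∑ k ∈ modes d n, Complex.exp (Complex.I * (phase k x : ℂ)) • a k

end TModelEuler

end

/-! The proof is an energy estimate for `e = w - v`, where `w` is the truncation of `u` to `F`. In
Fourier variables the Euler equations read `u_k' = -i ∑_{p+q=k} (k·u_p) A_k u_q`. For `k ∈ F` the
right-hand side is the interaction of `w` with itself plus a residual `R` that collects the pairs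
with a frequency outside `F`. Tested against a transversal field, every interaction becomes a
trilinear form `tri a b c = ∑_{p+q+k=0} (q·a_p)(b_q·c_k)`, skew in `b, c` when `a` is transversal
(`tri_antisymm`).

The memory term of the `t`-model is dissipative: with `g` the part in `G` of the interaction of `v`
with itself, it contributes `-t‖g‖²`. Skew symmetry brings all other terms to a form where the
derivative falls on `w`, or where `g` is paired with the interaction of `w` with itself. With `x =
‖e‖` and `y = ‖g‖` this gives `(x²)'/2 ≤ L x² + H x + t (H y + 2 L x y - y²)`, where `L` bounds `∑
|q| |w_q|` and `H` bounds both `R` on `F` and the interaction of `w` with itself on `G`. The term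
`-t y²` absorbs every `y` (`energy_estimate`), so no bound on `v` is needed and `m` plays no role in
the constants. Gronwall then gives `x² ≲ H²` (`resolved_error_le`).

It remains to bound `L` and `H`. Since `∑ (1+|k|²)^{-2}` converges for `d ≤ 3`, the `H³` bound
controls `L` (`tsum_weighted_sq_le`, `latticeSum_lt_top`). Both sums behind `H` involve only pairs
with a frequency outside `|k|_∞ ≤ n/2`; because `k·u_p = (k-p)·u_p` they cost one derivative, and
Young's inequality `ℓ¹ * ℓ² ⊆ ℓ²` yields `H ≲ L n^{1-s} ‖u‖_{H^s}` (`tsum_highSum_sq_le`). The modes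
of `u` outside `F` are smaller than this rate allows, and Parseval (`l2Norm_sub_trigPoly`) returns
to the `L²` norm. -/

namespace TModelEuler

noncomputable section

variable {d : ℕ}

/-! ### The period cell and periodicity -/

lemma cell_eq_preimage (d : ℕ) :
    cell d = (WithLp.ofLp : Space d → (Fin d → ℝ)) ⁻¹' Icc 0 (fun _ => 2 * Real.pi) := by
  ext x
  simp [cell, Pi.le_def, forall_and]

lemma isCompact_cell (d : ℕ) : IsCompact (cell d) := by
  rw [cell_eq_preimage]
  exact (PiLp.homeomorph 2 (fun _ : Fin d => ℝ)).isCompact_preimage.2 isCompact_Icc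

lemma measurableSet_cell (d : ℕ) : MeasurableSet (cell d) :=
  (isCompact_cell d).isClosed.measurableSet

instance (d : ℕ) : IsFiniteMeasure (volume.restrict (cell d)) :=
  ⟨by simpa using (isCompact_cell d).measure_lt_top⟩

lemma _root_.Continuous.integrable_cell {E : Type*} [NormedAddCommGroup E] {f : Space d → E}
    (hf : Continuous f) : Integrable f (volume.restrict (cell d)) :=
  hf.continuousOn.integrableOn_compact (isCompact_cell d)

lemma setIntegral_cell {E : Type*} [NormedAddCommGroup E] [NormedSpace ℝ E] (f : Space d → E) :
    ∫ x in cell d, f x = ∫ y in Icc (0 : Fin d → ℝ) (fun _ => 2 * Real.pi), f (WithLp.toLp 2 y) := by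
  rw [cell_eq_preimage]
  exact ((PiLp.volume_preserving_ofLp (Fin d)).setIntegral_preimage_emb
    (MeasurableEquiv.toLp 2 (Fin d → ℝ)).symm.measurableEmbedding
    (fun y => f (WithLp.toLp 2 y)) _)

lemma IsPeriodic.add_wave {α : Type*} {f : Space d → α} (hf : IsPeriodic f) (k : Wave d)
    (x : Space d) : f (x + WithLp.toLp 2 (fun i => 2 * Real.pi * k i)) = f x := by
  have h : Function.Periodic f
      (∑ j, k j • (EuclideanSpace.single j (2 * Real.pi) : Space d)) := by
    refine Finset.sum_induction _ (Function.Periodic f) (fun a b ha hb => ha.add_period hb)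
      (by simp [Function.Periodic]) (fun j _ => ?_)
    exact Function.Periodic.zsmul (fun x => hf x j) (k j)
  have e : (WithLp.toLp 2 (fun i => 2 * Real.pi * k i) : Space d) =
      ∑ j, k j • (EuclideanSpace.single j (2 * Real.pi) : Space d) := by
    ext i
    simp [Finset.sum_apply, Pi.single_apply, mul_comm]
  rw [e]
  exact h x

/-! ### Scalar Fourier series: inversion, products, Parseval -/

/-- The Fourier coefficient of a scalar function. -/
def scalarCoef (f : Space d → ℂ) (k : Wave d) : ℂ :=
  (((2 * Real.pi) ^ d)⁻¹ : ℝ) • ∫ x in cell d, Complex.exp (-(Complex.I * (phase k x : ℂ))) * f x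

lemma continuous_phase (k : Wave d) : Continuous (phase k) := by
  unfold phase; fun_prop

lemma norm_exp_I_mul (r : ℝ) : ‖Complex.exp (Complex.I * r)‖ = 1 := by
  rw [mul_comm]; exact Complex.norm_exp_ofReal_mul_I r

lemma norm_exp_neg_I_mul (r : ℝ) : ‖Complex.exp (-(Complex.I * r))‖ = 1 := by
  simpa using norm_exp_I_mul (-r)

lemma phase_add (k l : Wave d) (x : Space d) : phase (k + l) x = phase k x + phase l x := by
  simp [phase, add_mul, Finset.sum_add_distrib]

lemma phase_neg (k : Wave d) (x : Space d) : phase (-k) x = -phase k x := by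
  simp [phase]

lemma phase_sub (k l : Wave d) (x : Space d) : phase (k - l) x = phase k x - phase l x := by
  rw [sub_eq_add_neg, phase_add, phase_neg, sub_eq_add_neg]

lemma phase_periodic (k : Wave d) (x : Space d) (j : Fin d) :
    phase k (x + EuclideanSpace.single j (2 * Real.pi)) = phase k x + k j * (2 * Real.pi) := by
  simp [phase, mul_add, Finset.sum_add_distrib]

lemma exp_phase_periodic (k : Wave d) :
    IsPeriodic fun x : Space d => Complex.exp (Complex.I * (phase k x : ℂ)) := by
  intro x j
  simp only [phase_periodic]
  have : Complex.I * ((phase k x + k j * (2 * Real.pi) : ℝ) : ℂ) =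
      Complex.I * (phase k x : ℂ) + (k j : ℂ) * (2 * Real.pi * Complex.I) := by push_cast; ring
  simp only [this]
  rw [Complex.exp_add, Complex.exp_int_mul_two_pi_mul_I, mul_one]

/-- The function on the unit torus that a periodic function descends to. -/
def torusFun (f : Space d → ℂ) (θ : UnitAddTorus (Fin d)) : ℂ :=
  f (WithLp.toLp 2 fun i => 2 * Real.pi * (AddCircle.equivIoc 1 0 (θ i)).1)

/-- The representative in `(0, 1]` picked by `equivIoc` differs from `y` by an integer vector, which
becomes a period after scaling by `2π`. -/
lemma torusFun_coe {f : Space d → ℂ} (hf : IsPeriodic f) (y : Fin d → ℝ) :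
    torusFun f (fun i => (y i : UnitAddCircle)) = f (WithLp.toLp 2 fun i => 2 * Real.pi * y i) := by
  have h : ∀ i, ∃ k : ℤ, y i + k = (AddCircle.equivIoc 1 0 ((y i : ℝ) : UnitAddCircle)).1 := by
    intro i
    have h1 := AddCircle.coe_equivIoc (p := (1 : ℝ)) (a := 0) (y := ((y i : ℝ) : UnitAddCircle))
    obtain ⟨m, hm⟩ := (AddCircle.coe_eq_zero_iff 1).1
      (show (((AddCircle.equivIoc 1 0 ((y i : ℝ) : UnitAddCircle)).1 - y i : ℝ) :
        UnitAddCircle) = 0 by rw [AddCircle.coe_sub, h1, sub_self])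
    exact ⟨m, by rw [zsmul_one] at hm; linarith⟩
  choose k hk using h
  unfold torusFun
  rw [← hf.add_wave k (WithLp.toLp 2 fun i => 2 * Real.pi * y i)]
  congr 1
  ext i
  simp [← hk, mul_add]

/-- Continuity can be tested on `ℝ^d`: the covering map is a product of open quotient maps, and
openness is what makes the product a quotient map again. -/
lemma continuous_torusFun {f : Space d → ℂ} (hf : IsPeriodic f) (hc : Continuous f) :
    Continuous (torusFun f) := by
  have hq : IsOpenQuotientMap
      (Pi.map (fun (_ : Fin d) (y : ℝ) => (y : UnitAddCircle))) :=
    IsOpenQuotientMap.piMap (fun _ => QuotientAddGroup.isOpenQuotientMap_mk)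
  rw [hq.isQuotientMap.continuous_iff]
  have : torusFun f ∘ (Pi.map (fun (_ : Fin d) (y : ℝ) => (y : UnitAddCircle))) =
      fun y => f (WithLp.toLp 2 fun i => 2 * Real.pi * y i) := by
    ext y; exact torusFun_coe hf y
  rw [this]
  fun_prop

lemma mFourier_coe (k : Wave d) (y : Fin d → ℝ) :
    UnitAddTorus.mFourier k (fun i => (y i : UnitAddCircle)) =
      Complex.exp (Complex.I * (phase k (WithLp.toLp 2 fun i => 2 * Real.pi * y i) : ℂ)) := by
  simp only [UnitAddTorus.mFourier, ContinuousMap.coe_mk, fourier_coe_apply, phase,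
    ← Complex.exp_sum]
  congr 1
  push_cast
  rw [Finset.mul_sum]
  refine Finset.sum_congr rfl fun i _ => ?_
  ring_nf

open scoped Pointwise in
lemma mFourierCoeff_torusFun {f : Space d → ℂ} (hf : IsPeriodic f) (k : Wave d) :
    UnitAddTorus.mFourierCoeff (torusFun f) k = scalarCoef f k := by
  rw [UnitAddTorus.mFourierCoeff_eq_integral _ _ 0, scalarCoef, setIntegral_cell]
  simp only [torusFun_coe hf, mFourier_coe]
  have h2 : (0:ℝ) < 2 * Real.pi := by positivity
  have hs := Measure.setIntegral_comp_smul (volume : Measure (Fin d → ℝ))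
    (fun y => Complex.exp (-(Complex.I * (phase k (WithLp.toLp 2 y) : ℂ))) * f (WithLp.toLp 2 y))
    {x | ∀ i, x i ∈ Ioc ((0 : Fin d → ℝ) i) ((0 : Fin d → ℝ) i + 1)} h2.ne'
  have e1 : ∀ y : Fin d → ℝ, (WithLp.toLp 2 fun i => 2 * Real.pi * y i : Space d) =
      WithLp.toLp 2 ((2 * Real.pi) • y) := fun y => rfl
  have e2 : (2 * Real.pi) • {x : Fin d → ℝ | ∀ i, x i ∈ Ioc ((0 : Fin d → ℝ) i)
      ((0 : Fin d → ℝ) i + 1)} = Set.pi univ fun i => Ioc ((0 : Fin d → ℝ) i) (2 * Real.pi) := by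
    ext y
    rw [Set.mem_smul_set_iff_inv_smul_mem₀ h2.ne']
    simp only [Set.mem_ofPred_eq, Pi.smul_apply, smul_eq_mul, mem_pi, mem_univ, true_imp_iff, mem_Ioc,
      Pi.zero_apply, zero_add]
    refine forall_congr' fun i => ?_
    rw [inv_mul_le_iff₀ h2, mul_one, mul_pos_iff_of_pos_left (inv_pos.2 h2)]
  simp only [phase_neg, e1, smul_eq_mul, Complex.ofReal_neg, mul_neg]
  rw [hs, e2, Module.finrank_fin_fun, abs_of_pos (by positivity)]
  congr 1
  rw [volume_pi, setIntegral_congr_set (Measure.univ_pi_Ioc_ae_eq_Icc)]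

/-- A continuous periodic function with summable Fourier coefficients is its Fourier series. -/
lemma hasSum_scalarCoef {f : Space d → ℂ} (hf : IsPeriodic f) (hc : Continuous f)
    (hs : Summable fun k => scalarCoef f k) (x : Space d) :
    HasSum (fun k => scalarCoef f k * Complex.exp (Complex.I * (phase k x : ℂ))) (f x) := by
  let F : C(UnitAddTorus (Fin d), ℂ) := ⟨torusFun f, continuous_torusFun hf hc⟩
  have hF : Summable (UnitAddTorus.mFourierCoeff F) := by
    refine hs.congr fun k => (mFourierCoeff_torusFun hf k).symm
  have := UnitAddTorus.hasSum_mFourier_series_apply_of_summable hF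
    (fun i => ((x i / (2 * Real.pi) : ℝ) : UnitAddCircle))
  have hx : (WithLp.toLp 2 fun i => 2 * Real.pi * (x i / (2 * Real.pi)) : Space d) = x := by
    ext i; simp; field_simp
  have e : F (fun i => ((x i / (2 * Real.pi) : ℝ) : UnitAddCircle)) = f x := by
    change torusFun f _ = _
    rw [torusFun_coe hf, hx]
  rw [e] at this
  refine this.congr_fun fun k => ?_
  rw [mFourier_coe, hx]
  change scalarCoef f k * _ = UnitAddTorus.mFourierCoeff (torusFun f) k • _
  rw [mFourierCoeff_torusFun hf, smul_eq_mul]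

/-- The Fourier coefficients of a product. -/
lemma hasSum_scalarCoef_mul {f g : Space d → ℂ} (hf : IsPeriodic f) (hc : Continuous f)
    (hs : Summable fun k => ‖scalarCoef f k‖) (hg : Continuous g) (k : Wave d) :
    HasSum (fun p => scalarCoef f p * scalarCoef g (k - p)) (scalarCoef (fun x => f x * g x) k) := by
  have hint : ∀ p : Wave d, Integrable (fun x => scalarCoef f p *
      (Complex.exp (-(Complex.I * (phase (k - p) x : ℂ))) * g x)) (volume.restrict (cell d)) := by
    intro p
    have := continuous_phase (k - p)
    exact Continuous.integrable_cell (by fun_prop)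
  -- Only `f` is expanded in its series, which converges absolutely; summation and integration
  -- against `g` are then exchanged.
  have h := hasSum_integral_of_summable_integral_norm hint ?_
  · have h2 := h.const_smul (((2 * Real.pi) ^ d)⁻¹ : ℝ)
    have e : ∀ x, ∑' p, scalarCoef f p *
        (Complex.exp (-(Complex.I * (phase (k - p) x : ℂ))) * g x) =
        Complex.exp (-(Complex.I * (phase k x : ℂ))) * (f x * g x) := by
      intro x
      have h3 := (hasSum_scalarCoef hf hc hs.of_norm x).mul_right
        (Complex.exp (-(Complex.I * (phase k x : ℂ))) * g x)
      have h4 : ∀ p, scalarCoef f p * (Complex.exp (-(Complex.I * (phase (k - p) x : ℂ))) * g x) =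
          scalarCoef f p * Complex.exp (Complex.I * (phase p x : ℂ)) *
            (Complex.exp (-(Complex.I * (phase k x : ℂ))) * g x) := by
        intro p
        have : Complex.exp (-(Complex.I * (phase (k - p) x : ℂ))) =
            Complex.exp (Complex.I * (phase p x : ℂ)) *
              Complex.exp (-(Complex.I * (phase k x : ℂ))) := by
          rw [← Complex.exp_add, phase_sub]; congr 1; push_cast; ring
        rw [this]; ring
      simp only [h4]
      rw [h3.tsum_eq]
      ring
    simp only [e] at h2
    refine h2.congr_fun fun p => ?_
    rw [integral_const_mul, scalarCoef, scalarCoef]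
    simp only [Complex.real_smul]
    ring
  · simp only [norm_mul, norm_exp_neg_I_mul, one_mul, integral_const_mul]
    exact hs.mul_right _

lemma scalarCoef_conj (f : Space d → ℂ) (k : Wave d) :
    scalarCoef (fun x => (starRingEnd ℂ) (f x)) k = (starRingEnd ℂ) (scalarCoef f (-k)) := by
  simp only [scalarCoef, Complex.real_smul, map_mul, Complex.conj_ofReal, ← integral_conj,
    ← Complex.exp_conj, map_neg, Complex.conj_I, phase_neg, Complex.ofReal_neg]
  simp

lemma scalarCoef_zero_norm_sq (f : Space d → ℂ) :
    scalarCoef (fun x => f x * (starRingEnd ℂ) (f x)) 0 =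
      ((((2 * Real.pi) ^ d)⁻¹ * ∫ x in cell d, ‖f x‖ ^ 2 : ℝ) : ℂ) := by
  have : ∀ x : Space d, phase (0 : Wave d) x = 0 := fun x => by simp [phase]
  simp only [scalarCoef, this, Complex.mul_conj, Complex.real_smul, Complex.normSq_eq_norm_sq]
  rw [Complex.ofReal_mul, ← integral_complex_ofReal]
  simp

/-- Parseval's identity. -/
lemma hasSum_norm_sq_scalarCoef {f : Space d → ℂ} (hf : IsPeriodic f) (hc : Continuous f)
    (hs : Summable fun k => ‖scalarCoef f k‖) :
    HasSum (fun k => ‖scalarCoef f k‖ ^ 2)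
      (((2 * Real.pi) ^ d)⁻¹ * ∫ x in cell d, ‖f x‖ ^ 2) := by
  -- The product formula for `f` and its conjugate at frequency zero.
  have h := hasSum_scalarCoef_mul hf hc hs (g := fun x => (starRingEnd ℂ) (f x))
    (Complex.continuous_conj.comp hc) 0
  rw [scalarCoef_zero_norm_sq] at h
  rw [← Complex.hasSum_ofReal]
  refine h.congr_fun fun k => ?_
  rw [scalarCoef_conj, zero_sub, neg_neg, Complex.mul_conj, Complex.normSq_eq_norm_sq]

/-! ### Derivatives and Fourier coefficients -/

/-- The derivative of a periodic function has zero mean. -/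
lemma integral_cell_fderiv {f : Space d → ℂ} (hf : IsPeriodic f) (hc : ContDiff ℝ 1 f)
    (j : Fin d) : ∫ x in cell d, fderiv ℝ f x (EuclideanSpace.single j 1) = 0 := by
  obtain _ | n := d
  · exact j.elim0
  rw [setIntegral_cell]
  let e : (Fin (n + 1) → ℝ) ≃L[ℝ] Space (n + 1) :=
    (PiLp.continuousLinearEquiv 2 ℝ (fun _ : Fin (n + 1) => ℝ)).symm
  have hder : ∀ y : Fin (n + 1) → ℝ, HasFDerivAt (fun y => f (WithLp.toLp 2 y))
      ((fderiv ℝ f (WithLp.toLp 2 y)).comp (e : (Fin (n + 1) → ℝ) →L[ℝ] Space (n + 1))) y := by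
    intro y
    exact ((hc.differentiable one_ne_zero) (e y)).hasFDerivAt.comp y e.hasFDerivAt
  have hcont : Continuous fun y : Fin (n + 1) → ℝ => f (WithLp.toLp 2 y) :=
    hc.continuous.comp e.continuous
  have hcont' : Continuous fun y : Fin (n + 1) → ℝ =>
      fderiv ℝ f (WithLp.toLp 2 y) (EuclideanSpace.single j 1) :=
    ((hc.continuous_fderiv one_ne_zero).comp e.continuous).clm_apply continuous_const
  have hsum : ∀ y : Fin (n + 1) → ℝ, ∑ i, (if i = j then
      ((fderiv ℝ f (WithLp.toLp 2 y)).comp (e : (Fin (n + 1) → ℝ) →L[ℝ] Space (n + 1))) else 0)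
        (Pi.single i 1) = fderiv ℝ f (WithLp.toLp 2 y) (EuclideanSpace.single j 1) := by
    intro y
    rw [Finset.sum_eq_single j]
    · simp [e]
    · intro b _ hb; simp [hb]
    · simp
  -- Divergence theorem on the box for the field `f e_j`; the two faces orthogonal to `e_j` cancel
  -- by periodicity.
  have key := integral_divergence_of_hasFDerivAt_off_countable' (E := ℂ)
    (0 : Fin (n + 1) → ℝ) (fun _ => 2 * Real.pi) (fun i => by simp [Real.pi_pos.le])
    (fun i y => if i = j then f (WithLp.toLp 2 y) else 0)
    (fun i y => if i = j then
      ((fderiv ℝ f (WithLp.toLp 2 y)).comp (e : (Fin (n + 1) → ℝ) →L[ℝ] Space (n + 1))) else 0)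
    ∅ countable_empty ?_ ?_ ?_
  · simp only [hsum] at key
    rw [key]
    refine Finset.sum_eq_zero fun i _ => ?_
    by_cases h : i = j
    · subst h
      simp only [if_true]
      rw [sub_eq_zero]
      refine integral_congr_ae (Filter.Eventually.of_forall fun x => ?_)
      have := hf (WithLp.toLp 2 (i.insertNth 0 x)) i
      simp only [Pi.zero_apply]
      rw [← this]
      congr 1
      ext l
      refine Fin.succAboveCases i ?_ (fun m => ?_) l
      · simp
      · simp [Fin.succAbove_ne]
    · simp [h]
  · intro i
    by_cases h : i = j
    · simp only [h, if_true]; exact hcont.continuousOn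
    · simp only [h, if_false]; exact continuousOn_const
  · intro y _ i
    by_cases h : i = j
    · simp only [h, if_true]; exact hder y
    · simp only [h, if_false]; exact hasFDerivAt_const _ _
  · simp only [hsum]
    exact hcont'.continuousOn.integrableOn_compact isCompact_Icc

/-- `phase` as a linear functional. -/
def phaseL (k : Wave d) : Space d →L[ℝ] ℝ := ∑ i, (k i : ℝ) • EuclideanSpace.proj i

lemma phaseL_apply (k : Wave d) (x : Space d) : phaseL k x = phase k x := by
  simp [phaseL, phase]

lemma hasFDerivAt_phase (k : Wave d) (x : Space d) : HasFDerivAt (phase k) (phaseL k) x := by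
  have : phase k = phaseL k := by ext x; rw [phaseL_apply]
  rw [this]; exact (phaseL k).hasFDerivAt

lemma phase_single (k : Wave d) (j : Fin d) : phase k (EuclideanSpace.single j 1) = k j := by
  simp [phase]

lemma contDiff_phase (k : Wave d) : ContDiff ℝ 1 (phase k) := by
  have : phase k = phaseL k := by ext x; rw [phaseL_apply]
  rw [this]; exact (phaseL k).contDiff

lemma contDiff_exp_phase (k : Wave d) :
    ContDiff ℝ 1 fun x : Space d => Complex.exp (-(Complex.I * (phase k x : ℂ))) := by
  have := contDiff_phase k
  exact ((contDiff_const.mul (Complex.ofRealCLM.contDiff.comp this)).neg).cexp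

lemma fderiv_exp_phase (k : Wave d) (x : Space d) (j : Fin d) :
    fderiv ℝ (fun x : Space d => Complex.exp (-(Complex.I * (phase k x : ℂ)))) x
      (EuclideanSpace.single j 1) =
      -(Complex.I * k j) * Complex.exp (-(Complex.I * (phase k x : ℂ))) := by
  have h1 : HasFDerivAt (fun x : Space d => ((phase k x : ℝ) : ℂ))
      (Complex.ofRealCLM.comp (phaseL k)) x :=
    Complex.ofRealCLM.hasFDerivAt.comp x (hasFDerivAt_phase k x)
  have h2 := ((h1.const_mul Complex.I).fun_neg).cexp
  rw [h2.fderiv]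
  simp [phaseL_apply, phase_single]
  ring

/-- Differentiation multiplies Fourier coefficients by `i k_j`. -/
lemma scalarCoef_fderiv {f : Space d → ℂ} (hf : IsPeriodic f) (hc : ContDiff ℝ 1 f)
    (j : Fin d) (k : Wave d) :
    scalarCoef (fun x => fderiv ℝ f x (EuclideanSpace.single j 1)) k =
      Complex.I * k j * scalarCoef f k := by
  have hE := contDiff_exp_phase k
  have hper : IsPeriodic fun x => Complex.exp (-(Complex.I * (phase k x : ℂ))) * f x := by
    intro x l
    have := exp_phase_periodic (-k) x l
    simp only [phase_neg, Complex.ofReal_neg, mul_neg] at this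
    simp only [this, hf x l]
  -- Integration by parts: the product `e^{-ik·x} f` is periodic, so its derivative has zero mean.
  have h0 := integral_cell_fderiv hper (hE.mul hc) j
  have hd : ∀ x, fderiv ℝ (fun x => Complex.exp (-(Complex.I * (phase k x : ℂ))) * f x) x
      (EuclideanSpace.single j 1) =
      Complex.exp (-(Complex.I * (phase k x : ℂ))) * fderiv ℝ f x (EuclideanSpace.single j 1) -
        (Complex.I * k j) * (Complex.exp (-(Complex.I * (phase k x : ℂ))) * f x) := by
    intro x
    have h1 := ((hE.differentiable one_ne_zero) x).hasFDerivAt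
    have h2 := ((hc.differentiable one_ne_zero) x).hasFDerivAt
    rw [(h1.fun_mul h2).fderiv]
    simp only [add_apply, smul_apply, fderiv_exp_phase, smul_eq_mul]
    ring
  simp only [hd] at h0
  rw [integral_sub, sub_eq_zero, integral_const_mul] at h0
  · simp only [scalarCoef, h0, Complex.real_smul]; ring
  · exact Continuous.integrable_cell
      (hE.continuous.mul ((hc.continuous_fderiv one_ne_zero).clm_apply continuous_const))
  · exact (Continuous.integrable_cell (hE.continuous.mul hc.continuous)).const_mul _

lemma integrable_exp_mul {f : Space d → ℂ} (hf : Continuous f) (k : Wave d) :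
    Integrable (fun x => Complex.exp (-(Complex.I * (phase k x : ℂ))) * f x)
      (volume.restrict (cell d)) :=
  Continuous.integrable_cell ((contDiff_exp_phase k).continuous.mul hf)

lemma scalarCoef_add {f g : Space d → ℂ} (hf : Continuous f) (hg : Continuous g) (k : Wave d) :
    scalarCoef (fun x => f x + g x) k = scalarCoef f k + scalarCoef g k := by
  simp only [scalarCoef, mul_add]
  rw [integral_add (integrable_exp_mul hf k) (integrable_exp_mul hg k), smul_add]

lemma scalarCoef_const_mul (c : ℂ) (f : Space d → ℂ) (k : Wave d) :
    scalarCoef (fun x => c * f x) k = c * scalarCoef f k := by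
  simp only [scalarCoef, mul_left_comm _ c]
  rw [integral_const_mul, mul_smul_comm]

lemma scalarCoef_neg (f : Space d → ℂ) (k : Wave d) :
    scalarCoef (fun x => -f x) k = -scalarCoef f k := by
  simpa using scalarCoef_const_mul (-1) f k

lemma scalarCoef_zero (k : Wave d) : scalarCoef (fun _ : Space d => (0 : ℂ)) k = 0 := by
  simp [scalarCoef]

lemma scalarCoef_sum {ι : Type*} (s : Finset ι) {f : ι → Space d → ℂ}
    (hf : ∀ i, Continuous (f i)) (k : Wave d) :
    scalarCoef (fun x => ∑ i ∈ s, f i x) k = ∑ i ∈ s, scalarCoef (f i) k := by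
  simp only [scalarCoef, Finset.mul_sum]
  rw [integral_finsetSum s fun i _ => integrable_exp_mul (hf i) k, Finset.smul_sum]

/-! ### Fourier coefficients of vector fields -/

lemma continuous_toAmp : Continuous (toAmp : Space d → Amp d) := by
  unfold toAmp; fun_prop

lemma fourierCoef_apply {f : Space d → Space d} (hf : Continuous f) (k : Wave d) (j : Fin d) :
    fourierCoef f k j = scalarCoef (fun x => ((f x j : ℝ) : ℂ)) k := by
  have hint : Integrable (fun x => Complex.exp (-(Complex.I * (phase k x : ℂ))) • toAmp (f x))
      (volume.restrict (cell d)) :=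
    Continuous.integrable_cell ((contDiff_exp_phase k).continuous.smul (continuous_toAmp.comp hf))
  have := (EuclideanSpace.proj (𝕜 := ℂ) j : Amp d →L[ℂ] ℂ).integral_comp_comm hint
  simp only [fourierCoef, scalarCoef, PiLp.smul_apply]
  congr 1
  exact this.symm

lemma continuous_coord {f : Space d → Space d} (hf : Continuous f) (j : Fin d) :
    Continuous fun x => ((f x j : ℝ) : ℂ) := by fun_prop

lemma contDiff_coord {f : Space d → Space d} (hf : ContDiff ℝ 1 f) (j : Fin d) :
    ContDiff ℝ 1 fun x => ((f x j : ℝ) : ℂ) :=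
  Complex.ofRealCLM.contDiff.comp ((EuclideanSpace.proj (𝕜 := ℝ) j).contDiff.comp hf)

lemma fderiv_coord {f : Space d → Space d} (hf : ContDiff ℝ 1 f) (j : Fin d) (x v : Space d) :
    fderiv ℝ (fun x => ((f x j : ℝ) : ℂ)) x v = ((fderiv ℝ f x v j : ℝ) : ℂ) := by
  have h := Complex.ofRealCLM.hasFDerivAt.comp x
    ((EuclideanSpace.proj (𝕜 := ℝ) j).hasFDerivAt.comp x
      ((hf.differentiable one_ne_zero) x).hasFDerivAt)
  exact congrArg (fun L : Space d →L[ℝ] ℂ => L v) h.fderiv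

lemma IsPeriodic.coord {f : Space d → Space d} (hf : IsPeriodic f) (j : Fin d) :
    IsPeriodic fun x => ((f x j : ℝ) : ℂ) := fun x l => by simp only [hf x l]

lemma norm_coord_le (z : Amp d) (j : Fin d) : ‖z j‖ ≤ ‖z‖ := PiLp.norm_apply_le z j

/-- Fourier coefficients of an incompressible field are transversal. -/
lemma waveDot_fourierCoef {f : Space d → Space d} (hp : IsPeriodic f) (hf : ContDiff ℝ 1 f)
    (hdiv : ∀ x, divergence f x = 0) (k : Wave d) : waveDot k (fourierCoef f k) = 0 := by
  have h : ∑ j, scalarCoef (fun x => fderiv ℝ (fun x => ((f x j : ℝ) : ℂ)) x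
      (EuclideanSpace.single j 1)) k = 0 := by
    rw [← scalarCoef_sum, ← scalarCoef_zero k]
    · congr 1
      ext x
      have := hdiv x
      simp only [divergence] at this
      simp only [fderiv_coord hf]
      rw [← Complex.ofReal_sum, this, Complex.ofReal_zero]
    · exact fun j => ((contDiff_coord hf j).continuous_fderiv one_ne_zero).clm_apply
        continuous_const
  have h2 : ∀ j, scalarCoef (fun x => fderiv ℝ (fun x => ((f x j : ℝ) : ℂ)) x
      (EuclideanSpace.single j 1)) k = Complex.I * (k j * fourierCoef f k j) := fun j => by
    rw [scalarCoef_fderiv (hp.coord j) (contDiff_coord hf j), fourierCoef_apply hf.continuous,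
      mul_assoc]
  simp only [h2, ← Finset.mul_sum, mul_eq_zero, Complex.I_ne_zero, false_or] at h
  exact h

lemma fderiv_apply_eq_sum {E : Type*} [NormedAddCommGroup E] [NormedSpace ℝ E]
    (L : Space d →L[ℝ] E) (v : Space d) : L v = ∑ l, v l • L (EuclideanSpace.single l 1) := by
  have : v = ∑ l, v l • (EuclideanSpace.single l 1 : Space d) := by
    ext i; simp [Finset.sum_apply, Pi.single_apply]
  conv_lhs => rw [this]
  simp

/-- The Fourier coefficients of `(f·∇)f`. -/
lemma hasSum_advection {f : Space d → Space d} (hp : IsPeriodic f) (hf : ContDiff ℝ 1 f)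
    (hdiv : ∀ x, divergence f x = 0) (hs : Summable fun k => ‖fourierCoef f k‖)
    (k : Wave d) (i : Fin d) :
    HasSum (fun q => Complex.I * waveDot k (fourierCoef f q) * fourierCoef f (k - q) i)
      (scalarCoef (fun x => ((fderiv ℝ f x (f x) i : ℝ) : ℂ)) k) := by
  -- Incompressibility gives `(f·∇)f^i = ∑_l ∂_l (f^l f^i)`, so the derivative contributes only the
  -- factor `i k_l` to a convolution.
  have hc := hf.continuous
  have hprod : ∀ l, HasSum (fun q => Complex.I * k l * (fourierCoef f q l *
      fourierCoef f (k - q) i)) (scalarCoef (fun x => fderiv ℝ (fun x => ((f x l : ℝ) : ℂ) *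
        ((f x i : ℝ) : ℂ)) x (EuclideanSpace.single l 1)) k) := by
    intro l
    rw [scalarCoef_fderiv (f := fun x => ((f x l : ℝ) : ℂ) * ((f x i : ℝ) : ℂ))
      (fun x j => by simp only [hp x j]) ((contDiff_coord hf l).mul (contDiff_coord hf i))]
    refine HasSum.mul_left _ ?_
    have := hasSum_scalarCoef_mul (hp.coord l) (continuous_coord hc l) ?_
      (continuous_coord hc i) k
    · refine this.congr_fun fun q => ?_
      rw [fourierCoef_apply hc, fourierCoef_apply hc]
    · refine hs.of_nonneg_of_le (fun _ => norm_nonneg _) fun q => ?_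
      rw [← fourierCoef_apply hc]
      exact norm_coord_le _ _
  have h := hasSum_sum (s := Finset.univ) fun l _ => hprod l
  rw [← scalarCoef_sum] at h
  · convert h using 1
    · ext q
      simp only [waveDot, Finset.mul_sum, Finset.sum_mul]
      refine Finset.sum_congr rfl fun l _ => ?_
      ring
    · congr 1
      ext x
      have h3 : ∀ l, fderiv ℝ (fun x => ((f x l : ℝ) : ℂ) * ((f x i : ℝ) : ℂ)) x
          (EuclideanSpace.single l 1) = ((f x l * fderiv ℝ f x (EuclideanSpace.single l 1) i +
            f x i * fderiv ℝ f x (EuclideanSpace.single l 1) l : ℝ) : ℂ) := by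
        intro l
        have h1 := (((contDiff_coord hf l).differentiable one_ne_zero) x).hasFDerivAt
        have h2 := (((contDiff_coord hf i).differentiable one_ne_zero) x).hasFDerivAt
        rw [(h1.fun_mul h2).fderiv]
        simp only [add_apply, smul_apply, fderiv_coord hf, smul_eq_mul]
        push_cast; ring
      simp only [h3]
      rw [← Complex.ofReal_sum, Finset.sum_add_distrib, ← Finset.mul_sum]
      have := hdiv x
      simp only [divergence] at this
      rw [this, mul_zero, add_zero, fderiv_apply_eq_sum (fderiv ℝ f x) (f x)]
      simp [Finset.sum_apply]
  · intro l
    exact (((contDiff_coord hf l).mul (contDiff_coord hf i)).continuous_fderiv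
      one_ne_zero).clm_apply continuous_const

/-! ### Transversality and the projection `A_k` -/

lemma waveDot_add (k : Wave d) (y z : Amp d) : waveDot k (y + z) = waveDot k y + waveDot k z := by
  simp [waveDot, mul_add, Finset.sum_add_distrib]

lemma waveDot_smul (k : Wave d) (c : ℂ) (z : Amp d) : waveDot k (c • z) = c * waveDot k z := by
  simp only [waveDot, PiLp.smul_apply, smul_eq_mul, Finset.mul_sum]
  exact Finset.sum_congr rfl fun i _ => by ring

lemma waveDot_zero_right (k : Wave d) : waveDot k (0 : Amp d) = 0 := by simp [waveDot]

lemma waveDot_add_left (k l : Wave d) (z : Amp d) :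
    waveDot (k + l) z = waveDot k z + waveDot l z := by
  simp [waveDot, add_mul, Finset.sum_add_distrib]

lemma waveDot_neg_left (k : Wave d) (z : Amp d) : waveDot (-k) z = -waveDot k z := by
  simp [waveDot]

lemma waveDot_zero_left (z : Amp d) : waveDot 0 z = 0 := by simp [waveDot]

lemma waveSq_nonneg (k : Wave d) : 0 ≤ waveSq k := Finset.sum_nonneg fun _ _ => sq_nonneg _

lemma waveSq_neg (k : Wave d) : waveSq (-k) = waveSq k := by simp [waveSq]

lemma eq_zero_of_waveSq {k : Wave d} (h : waveSq k = 0) : k = 0 := by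
  ext i
  have := (Finset.sum_eq_zero_iff_of_nonneg fun i _ => sq_nonneg ((k i : ℤ) : ℝ)).1 h i
    (Finset.mem_univ i)
  simpa using this

/-- `proj k` as a linear map. -/
def projL (k : Wave d) : Amp d →ₗ[ℂ] Amp d where
  toFun := proj k
  map_add' y z := by ext i; simp [proj, waveDot_add]; ring
  map_smul' c z := by ext i; simp [proj, waveDot_smul]; ring

lemma projL_apply (k : Wave d) (z : Amp d) : projL k z = proj k z := rfl

lemma proj_zero_right (k : Wave d) : proj k (0 : Amp d) = 0 := (projL k).map_zero

lemma proj_eq_self {k : Wave d} {z : Amp d} (h : waveDot k z = 0) : proj k z = z := by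
  ext i; simp [proj, h]

lemma waveDot_wave (k : Wave d) (c : ℂ) :
    waveDot k (WithLp.toLp 2 fun i => (k i : ℂ) * c) = (waveSq k : ℂ) * c := by
  simp only [waveDot, waveSq]
  push_cast
  rw [Finset.sum_mul]
  exact Finset.sum_congr rfl fun i _ => by ring

lemma proj_wave (k : Wave d) (c : ℂ) : proj k (WithLp.toLp 2 fun i => (k i : ℂ) * c) = 0 := by
  by_cases h : waveSq k = 0
  · have := eq_zero_of_waveSq h
    subst this
    ext i; simp [proj]
  · ext i
    have : (waveSq k : ℂ) ≠ 0 := by exact_mod_cast h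
    simp only [proj, waveDot_wave, PiLp.zero_apply]
    field_simp
    ring

lemma waveDot_proj (k : Wave d) (z : Amp d) : waveDot k (proj k z) = 0 := by
  by_cases h : waveSq k = 0
  · rw [eq_zero_of_waveSq h, waveDot_zero_left]
  · have h' : (waveSq k : ℂ) ≠ 0 := by exact_mod_cast h
    have : proj k z = z + (-1 : ℂ) • WithLp.toLp 2 fun i =>
        (k i : ℂ) * (waveDot k z / (waveSq k : ℂ)) := by
      ext i; simp [proj]; ring
    rw [this, waveDot_add, waveDot_smul, waveDot_wave]
    field_simp
    ring

lemma norm_waveDot_le (k : Wave d) (z : Amp d) : ‖waveDot k z‖ ≤ √(waveSq k) * ‖z‖ := by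
  have h : waveDot k z = inner ℂ (WithLp.toLp 2 fun i => (k i : ℂ) : Amp d) z := by
    simp [waveDot, PiLp.inner_apply, mul_comm]
  have h2 : ‖(WithLp.toLp 2 fun i => (k i : ℂ) : Amp d)‖ = √(waveSq k) := by
    simp [EuclideanSpace.norm_eq, waveSq]
  rw [h, ← h2]
  exact norm_inner_le_norm _ _

lemma norm_wave (k : Wave d) (c : ℂ) :
    ‖(WithLp.toLp 2 fun i => (k i : ℂ) * c : Amp d)‖ = √(waveSq k) * ‖c‖ := by
  have : (WithLp.toLp 2 fun i => (k i : ℂ) * c : Amp d) =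
      c • WithLp.toLp 2 fun i => (k i : ℂ) := by ext i; simp [mul_comm]
  rw [this, norm_smul, mul_comm]
  simp [EuclideanSpace.norm_eq, waveSq]

/-- The triangle inequality is enough here; it costs a factor `2` against the sharp
orthogonal-projection bound. -/
lemma norm_proj_le (k : Wave d) (z : Amp d) : ‖proj k z‖ ≤ 2 * ‖z‖ := by
  have e : proj k z = z - WithLp.toLp 2 fun i => (k i : ℂ) * (waveDot k z / (waveSq k : ℂ)) := by
    ext i; simp [proj]; ring
  rw [e]
  refine (norm_sub_le _ _).trans ?_
  rw [norm_wave, norm_div, Complex.norm_real, Real.norm_of_nonneg (waveSq_nonneg k), two_mul]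
  gcongr
  rw [← mul_div_assoc]
  refine div_le_of_le_mul₀ (waveSq_nonneg k) (norm_nonneg _) ?_
  calc √(waveSq k) * ‖waveDot k z‖ ≤ √(waveSq k) * (√(waveSq k) * ‖z‖) := by
        gcongr; exact norm_waveDot_le k z
    _ = ‖z‖ * waveSq k := by rw [← mul_assoc, Real.mul_self_sqrt (waveSq_nonneg k), mul_comm]

/-! ### The Euler equations in Fourier variables -/

namespace IsEulerSolution

variable {T : ℝ} {u : ℝ → Space d → Space d} {p : ℝ → Space d → ℝ}

lemma contDiff_slice (h : IsEulerSolution T u p) {t : ℝ} (ht : t ∈ Icc 0 T) :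
    ContDiff ℝ 1 (u t) := by
  rw [← contDiffOn_univ]
  exact h.contDiffOn.comp (g := fun z : ℝ × Space d => u z.1 z.2) (f := fun x => (t, x))
    (contDiff_const.prodMk contDiff_id).contDiffOn (fun x _ => ⟨ht, mem_univ _⟩)

lemma waveDot_coef (h : IsEulerSolution T u p) {t : ℝ} (ht : t ∈ Icc 0 T) (k : Wave d) :
    waveDot k (fourierCoef (u t) k) = 0 :=
  waveDot_fourierCoef (h.periodic t ht) (h.contDiff_slice ht) (h.incompressible t ht) k

/-- Dominated convergence, with `u` bounded on the compact set `[0, T] × cell`. Continuity up to the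
endpoints complements differentiability in the interior in the Gronwall argument. -/
lemma continuousOn_scalarCoef (h : IsEulerSolution T u p) (k : Wave d) (j : Fin d) :
    ContinuousOn (fun t => scalarCoef (fun x => ((u t x j : ℝ) : ℂ)) k) (Icc 0 T) := by
  unfold scalarCoef
  refine ContinuousOn.fun_const_smul ?_ _
  have hU := h.contDiffOn.continuousOn
  obtain ⟨B, hB⟩ := (isCompact_Icc.prod (isCompact_cell d)).exists_bound_of_continuousOn
    (hU.mono (prod_mono_right (subset_univ _)))
  refine continuousOn_of_dominated (bound := fun _ => B) (fun t ht => ?_) (fun t ht => ?_)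
    (integrable_const _) (Filter.Eventually.of_forall fun x => ?_)
  · exact (integrable_exp_mul (continuous_coord (h.contDiff_slice ht).continuous j)
      k).aestronglyMeasurable
  · refine (ae_restrict_mem (measurableSet_cell d)).mono fun x hx => ?_
    rw [norm_mul, norm_exp_neg_I_mul, one_mul, Complex.norm_real]
    exact (PiLp.norm_apply_le _ _).trans (hB (t, x) ⟨ht, hx⟩)
  · refine continuousOn_const.mul ?_
    have : ContinuousOn (fun t => u t x) (Icc 0 T) :=
      hU.comp (f := fun t => (t, x)) (by fun_prop) (fun t ht => ⟨ht, mem_univ _⟩)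
    fun_prop

lemma continuousOn_coef (h : IsEulerSolution T u p) (k : Wave d) :
    ContinuousOn (fun t => fourierCoef (u t) k) (Icc 0 T) := by
  have h1 : ContinuousOn (fun t => WithLp.ofLp (fourierCoef (u t) k)) (Icc 0 T) := by
    refine continuousOn_pi.2 fun j => (h.continuousOn_scalarCoef k j).congr fun t ht => ?_
    exact fourierCoef_apply (h.contDiff_slice ht).continuous k j
  exact (PiLp.continuous_toLp 2 _).comp_continuousOn h1

/-- Differentiation under the integral. On the open slab the full derivative of `u` is continuous,
hence bounded on a closed time ball times the cell. -/
lemma hasDerivAt_scalarCoef (h : IsEulerSolution T u p) {t : ℝ} (ht : t ∈ Ioo 0 T)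
    (k : Wave d) (j : Fin d) :
    HasDerivAt (fun τ => scalarCoef (fun x => ((u τ x j : ℝ) : ℂ)) k)
      (scalarCoef (fun x => ((derivWithin (fun τ => u τ x) (Icc 0 T) t j : ℝ) : ℂ)) k) t := by
  set U : ℝ × Space d → Space d := fun z => u z.1 z.2 with hUdef
  have hopen : IsOpen (Ioo 0 T ×ˢ (univ : Set (Space d))) := isOpen_Ioo.prod isOpen_univ
  have hU : ContDiffOn ℝ 1 U (Ioo 0 T ×ˢ univ) :=
    h.contDiffOn.mono (prod_mono_left Ioo_subset_Icc_self)
  have hcont := hU.continuousOn_fderiv_of_isOpen hopen le_rfl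
  have hder : ∀ τ ∈ Ioo 0 T, ∀ x, HasDerivAt (fun τ => u τ x) (fderiv ℝ U (τ, x) (1, 0)) τ := by
    intro τ hτ x
    have h1 : HasFDerivAt U (fderiv ℝ U (τ, x)) (τ, x) :=
      ((hU.differentiableOn one_ne_zero).differentiableAt
        (hopen.mem_nhds ⟨hτ, mem_univ _⟩)).hasFDerivAt
    exact h1.comp_hasDerivAt τ ((hasDerivAt_id τ).prodMk (hasDerivAt_const τ x))
  have hw : ∀ x, derivWithin (fun τ => u τ x) (Icc 0 T) t = fderiv ℝ U (t, x) (1, 0) := fun x =>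
    (hder t ht x).hasDerivWithinAt.derivWithin
      (uniqueDiffOn_Icc (ht.1.trans ht.2) t (Ioo_subset_Icc_self ht))
  simp only [hw]
  obtain ⟨ε, hε, hball⟩ := Metric.nhds_basis_closedBall.mem_iff.1 (isOpen_Ioo.mem_nhds ht)
  have hcontV : ContinuousOn (fun z => fderiv ℝ U z (1, 0)) (Ioo 0 T ×ˢ univ) :=
    hcont.clm_apply continuousOn_const
  obtain ⟨B, hB⟩ := ((isCompact_closedBall t ε).prod
    (isCompact_cell d)).exists_bound_of_continuousOn
    (hcontV.mono (prod_mono hball (subset_univ _)))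
  have hslice : Continuous fun x => fderiv ℝ U (t, x) (1, 0) := by
    rw [← continuousOn_univ]
    exact hcontV.comp (f := fun x => (t, x)) (by fun_prop) (fun x _ => ⟨ht, mem_univ _⟩)
  refine HasDerivAt.fun_const_smul _ ?_
  refine (hasDerivAt_integral_of_dominated_loc_of_deriv_le (bound := fun _ => B)
    (F' := fun τ x => Complex.exp (-(Complex.I * (phase k x : ℂ))) *
      ((fderiv ℝ U (τ, x) (1, 0) j : ℝ) : ℂ))
    (Metric.closedBall_mem_nhds t hε) ?_ ?_ ?_ ?_ (integrable_const _) ?_).2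
  · filter_upwards [isOpen_Ioo.mem_nhds ht] with τ hτ
    exact (integrable_exp_mul (continuous_coord
      (h.contDiff_slice (Ioo_subset_Icc_self hτ)).continuous j) k).aestronglyMeasurable
  · exact integrable_exp_mul (continuous_coord
      (h.contDiff_slice (Ioo_subset_Icc_self ht)).continuous j) k
  · exact (integrable_exp_mul (continuous_coord hslice j) k).aestronglyMeasurable
  · refine (ae_restrict_mem (measurableSet_cell d)).mono fun x hx τ hτ => ?_
    rw [norm_mul, norm_exp_neg_I_mul, one_mul, Complex.norm_real]
    exact (PiLp.norm_apply_le _ _).trans (hB (τ, x) ⟨hτ, hx⟩)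
  · refine Filter.Eventually.of_forall fun x τ hτ => HasDerivAt.const_mul _ ?_
    have h2 := ((EuclideanSpace.proj (𝕜 := ℝ) j : Space d →L[ℝ] ℝ)).hasFDerivAt.comp_hasDerivAt τ
      (hder τ (hball hτ) x)
    exact h2.ofReal_comp

/-- The Euler equations in Fourier variables. -/
lemma hasDerivAt_coef (h : IsEulerSolution T u p) {t : ℝ} (ht : t ∈ Ioo 0 T)
    (hs : Summable fun k => ‖fourierCoef (u t) k‖) (k : Wave d) :
    ∃ D, HasDerivAt (fun τ => fourierCoef (u τ) k) D t ∧
      HasSum (fun q => (-Complex.I) • waveDot k (fourierCoef (u t) q) •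
        proj k (fourierCoef (u t) (k - q))) D := by
  have ht' := Ioo_subset_Icc_self ht
  have hper := h.periodic t ht'
  have hcd := h.contDiff_slice ht'
  set D : Amp d := WithLp.toLp 2 fun j =>
    scalarCoef (fun x => ((derivWithin (fun τ => u τ x) (Icc 0 T) t j : ℝ) : ℂ)) k with hD
  have hderiv : HasDerivAt (fun τ => fourierCoef (u τ) k) D t := by
    have h1 : HasDerivAt (fun τ => (WithLp.toLp 2 fun j =>
        scalarCoef (fun x => ((u τ x j : ℝ) : ℂ)) k : Amp d)) D t :=
      (PiLp.continuousLinearEquiv 2 ℝ (fun _ : Fin d => ℂ)).symm.hasFDerivAt.comp_hasDerivAt t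
        (hasDerivAt_pi.2 fun j => h.hasDerivAt_scalarCoef ht k j)
    refine h1.congr_of_eventuallyEq ?_
    filter_upwards [isOpen_Ioo.mem_nhds ht] with τ hτ
    ext j
    exact fourierCoef_apply (h.contDiff_slice (Ioo_subset_Icc_self hτ)).continuous k j
  refine ⟨D, hderiv, ?_⟩
  -- The relation `k·u_k = 0` persists in time, so the time derivative is transversal too.
  have hDdiv : waveDot k D = 0 := by
    have h1 : HasDerivAt (fun τ => waveDot k (fourierCoef (u τ) k)) (waveDot k D) t := by
      have h2 : ∀ i, HasDerivAt (fun τ => fourierCoef (u τ) k i) (D i) t := fun i =>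
        (EuclideanSpace.proj (𝕜 := ℂ) i : Amp d →L[ℂ] ℂ).restrictScalars
          ℝ |>.hasFDerivAt.comp_hasDerivAt t hderiv
      exact HasDerivAt.fun_sum fun i _ => (h2 i).const_mul _
    have h2 : (fun τ => waveDot k (fourierCoef (u τ) k)) =ᶠ[nhds t] fun _ => 0 := by
      filter_upwards [isOpen_Ioo.mem_nhds ht] with τ hτ
      exact h.waveDot_coef (Ioo_subset_Icc_self hτ) k
    exact h1.unique ((hasDerivAt_const t (0 : ℂ)).congr_of_eventuallyEq h2)
  set P : ℂ := scalarCoef (fun x => ((p t x : ℝ) : ℂ)) k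
  set A : Amp d := WithLp.toLp 2 fun i =>
    scalarCoef (fun x => ((fderiv ℝ (u t) x (u t x) i : ℝ) : ℂ)) k with hA
  have hpc : ContDiff ℝ 1 fun x => ((p t x : ℝ) : ℂ) :=
    Complex.ofRealCLM.contDiff.comp (h.contDiff_pressure t ht')
  have hpp : IsPeriodic fun x => ((p t x : ℝ) : ℂ) := fun x j => by
    simp only [h.periodic_pressure t ht' x j]
  have hDA : D = (-1 : ℂ) • A + (-1 : ℂ) • WithLp.toLp 2 fun i => (k i : ℂ) * (Complex.I * P) := by
    ext i
    have h1 : ∀ x, ((derivWithin (fun τ => u τ x) (Icc 0 T) t i : ℝ) : ℂ) =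
        -((fderiv ℝ (u t) x (u t x) i : ℝ) : ℂ) +
          -fderiv ℝ (fun x => ((p t x : ℝ) : ℂ)) x (EuclideanSpace.single i 1) := by
      intro x
      have h2 := congrArg (fun z : Space d => z i) (h.momentum t ht' x)
      have h3 : fderiv ℝ (fun x => ((p t x : ℝ) : ℂ)) x (EuclideanSpace.single i 1) =
          ((gradient (p t) x i : ℝ) : ℂ) := by
        have h4 := Complex.ofRealCLM.hasFDerivAt.comp x
          (((h.contDiff_pressure t ht').differentiable one_ne_zero) x).hasFDerivAt
        have h5 : gradient (p t) x i = fderiv ℝ (p t) x (EuclideanSpace.single i 1) := by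
          rw [← inner_gradient_left, EuclideanSpace.inner_single_right]
          simp
        rw [h5]
        exact congrArg (fun L : Space d →L[ℝ] ℂ => L (EuclideanSpace.single i 1)) h4.fderiv
      rw [h3]
      simp only [PiLp.add_apply, PiLp.neg_apply] at h2
      rw [← Complex.ofReal_neg, ← Complex.ofReal_neg, ← Complex.ofReal_add]
      congr 1
      linarith
    have c1 : Continuous fun x => ((fderiv ℝ (u t) x (u t x) i : ℝ) : ℂ) :=
      continuous_coord ((hcd.continuous_fderiv one_ne_zero).clm_apply hcd.continuous) i
    have c2 : Continuous fun x => fderiv ℝ (fun x => ((p t x : ℝ) : ℂ)) x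
        (EuclideanSpace.single i 1) :=
      (hpc.continuous_fderiv one_ne_zero).clm_apply continuous_const
    simp only [hD, hA, h1, PiLp.add_apply, PiLp.smul_apply, smul_eq_mul]
    rw [scalarCoef_add c1.fun_neg c2.fun_neg, scalarCoef_neg, scalarCoef_neg, scalarCoef_fderiv hpp hpc]
    ring
  have hAsum : HasSum (fun q => (Complex.I * waveDot k (fourierCoef (u t) q)) •
      fourierCoef (u t) (k - q)) A := by
    have h1 : HasSum (fun q => fun i => (Complex.I * waveDot k (fourierCoef (u t) q)) *
        fourierCoef (u t) (k - q) i) A.ofLp :=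
      Pi.hasSum.2 fun i => hasSum_advection hper hcd (h.incompressible t ht') hs k i
    exact h1.map (PiLp.continuousLinearEquiv 2 ℂ (fun _ : Fin d => ℂ)).symm
      (PiLp.continuousLinearEquiv 2 ℂ (fun _ : Fin d => ℂ)).symm.continuous
  -- `A_k` fixes the transversal `D` and kills the pressure gradient, which is parallel to `k`.
  have h5 : D = (-1 : ℂ) • projL k A := by
    have h6 : projL k (WithLp.toLp 2 fun i => (k i : ℂ) * (Complex.I * P)) = 0 := proj_wave k _
    conv_lhs => rw [← proj_eq_self hDdiv, hDA, ← projL_apply, map_add, map_smul, map_smul, h6,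
      smul_zero, add_zero]
  rw [h5]
  refine ((hAsum.map (projL k) (LinearMap.continuous_of_finiteDimensional _)).const_smul
    (-1 : ℂ)).congr_fun fun q => ?_
  simp only [Function.comp, map_smul, projL_apply, smul_smul]
  congr 1
  ring

end IsEulerSolution

/-! ### Bilinear pairing, conjugation symmetry and the algebra of interactions -/

/-- The bilinear dot product of amplitudes. -/
def dotA (y z : Amp d) : ℂ := ∑ i, y i * z i

lemma dotA_add_left (x y z : Amp d) : dotA (x + y) z = dotA x z + dotA y z := by
  simp [dotA, add_mul, Finset.sum_add_distrib]

lemma dotA_smul_left (c : ℂ) (y z : Amp d) : dotA (c • y) z = c * dotA y z := by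
  simp [dotA, Finset.mul_sum, mul_assoc]

lemma dotA_zero_left (z : Amp d) : dotA 0 z = 0 := by simp [dotA]

lemma dotA_zero_right (z : Amp d) : dotA z 0 = 0 := by simp [dotA]

lemma dotA_comm (y z : Amp d) : dotA y z = dotA z y := by
  simp only [dotA, mul_comm]

lemma dotA_sum_left {ι : Type*} (s : Finset ι) (f : ι → Amp d) (z : Amp d) :
    dotA (∑ i ∈ s, f i) z = ∑ i ∈ s, dotA (f i) z := by
  classical
  induction s using Finset.induction_on with
  | empty => simp [dotA_zero_left]
  | insert a s ha ih => rw [Finset.sum_insert ha, Finset.sum_insert ha, dotA_add_left, ih]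

/-- The amplitude with conjugate coordinates. -/
def conjA (z : Amp d) : Amp d := WithLp.toLp 2 fun i => (starRingEnd ℂ) (z i)

lemma norm_conjA (z : Amp d) : ‖conjA z‖ = ‖z‖ := by
  simp [conjA, EuclideanSpace.norm_eq]

lemma dotA_conjA (y z : Amp d) : dotA y (conjA z) = inner ℂ z y := by
  simp [dotA, conjA, PiLp.inner_apply]

lemma norm_dotA_le (y z : Amp d) : ‖dotA y z‖ ≤ ‖y‖ * ‖z‖ := by
  have : z = conjA (conjA z) := by ext i; simp [conjA]
  rw [this, dotA_conjA, norm_conjA, mul_comm]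
  exact norm_inner_le_norm _ _

/-- `A_k` only subtracts a multiple of `k`, which pairs to zero with a transversal vector. -/
lemma dotA_proj {k : Wave d} (y : Amp d) {z : Amp d} (h : waveDot k z = 0) :
    dotA (proj k y) z = dotA y z := by
  have : dotA (proj k y) z = dotA y z - waveDot k y / (waveSq k : ℂ) * waveDot k z := by
    generalize hc : waveDot k y = c
    simp only [dotA, proj, hc]
    simp only [waveDot, Finset.mul_sum]
    rw [← Finset.sum_sub_distrib]
    exact Finset.sum_congr rfl fun i _ => by ring
  rw [this, h, mul_zero, sub_zero]

/-- Conjugate reflection of a family of amplitudes; fixed points are the Fourier coefficients of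
real fields. -/
def reflect (a : Wave d → Amp d) (k : Wave d) : Amp d := conjA (a (-k))

lemma waveDot_conjA (k : Wave d) (z : Amp d) :
    waveDot k (conjA z) = (starRingEnd ℂ) (waveDot k z) := by
  simp [waveDot, conjA]

lemma proj_conjA (k : Wave d) (z : Amp d) : proj k (conjA z) = conjA (proj k z) := by
  ext i
  simp [proj, conjA]
  simp [waveDot]

lemma proj_neg_wave (k : Wave d) (z : Amp d) : proj (-k) z = proj k z := by
  ext i
  simp [proj, waveDot_neg_left, waveSq_neg]

lemma conjA_smul (c : ℂ) (z : Amp d) : conjA (c • z) = (starRingEnd ℂ) c • conjA z := by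
  ext i; simp [conjA]

lemma conjA_add (y z : Amp d) : conjA (y + z) = conjA y + conjA z := by
  ext i; simp [conjA]

lemma conjA_sub (y z : Amp d) : conjA (y - z) = conjA y - conjA z := by
  ext i; simp [conjA]

lemma conjA_sum {ι : Type*} (s : Finset ι) (f : ι → Amp d) :
    conjA (∑ i ∈ s, f i) = ∑ i ∈ s, conjA (f i) := by
  ext i; simp [conjA]

lemma interaction_congr {P Q : Finset (Wave d)} {a a' b b' : Wave d → Amp d}
    (ha : ∀ k ∈ P, a k = a' k) (hb : ∀ k ∈ Q, b k = b' k) (k : Wave d) :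
    interaction P Q a b k = interaction P Q a' b' k := by
  unfold interaction
  congr 1
  refine Finset.sum_congr rfl fun r hr => ?_
  simp only [Finset.mem_filter, Finset.mem_product] at hr
  rw [ha _ hr.1.1, hb _ hr.1.2]

lemma interaction_smul_left (P Q : Finset (Wave d)) (c : ℂ) (a b : Wave d → Amp d) (k : Wave d) :
    interaction P Q (fun q => c • a q) b k = c • interaction P Q a b k := by
  simp only [interaction, waveDot_smul, Finset.smul_sum, smul_smul]
  exact Finset.sum_congr rfl fun i _ => by congr 1; ring

lemma interaction_smul_right (P Q : Finset (Wave d)) (c : ℂ) (a b : Wave d → Amp d)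
    (k : Wave d) : interaction P Q a (fun q => c • b q) k = c • interaction P Q a b k := by
  simp only [interaction, ← projL_apply, map_smul, Finset.smul_sum, smul_smul]
  exact Finset.sum_congr rfl fun i _ => by congr 1; ring

lemma waveDot_interaction (P Q : Finset (Wave d)) (a b : Wave d → Amp d) (k : Wave d) :
    waveDot k (interaction P Q a b k) = 0 := by
  have h : interaction P Q a b k = proj k ((-Complex.I) • ∑ r ∈ P ×ˢ Q with r.1 + r.2 = k,
      waveDot k (a r.1) • b r.2) := by
    simp only [interaction, ← projL_apply, map_smul, map_sum]
  rw [h, waveDot_proj]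

lemma interaction_zero_wave (P Q : Finset (Wave d)) (a b : Wave d → Amp d) :
    interaction P Q a b 0 = 0 := by
  simp [interaction, waveDot_zero_left]

/-- Under `(p, q) ↦ (-p, -q)` the sign of the linear factor `k` compensates for the conjugation of
`-i`. -/
lemma interaction_reflect {P Q : Finset (Wave d)} (hP : ∀ k, -k ∈ P ↔ k ∈ P)
    (hQ : ∀ k, -k ∈ Q ↔ k ∈ Q) (a b : Wave d → Amp d) (k : Wave d) :
    interaction P Q (reflect a) (reflect b) k = reflect (interaction P Q a b) k := by
  simp only [reflect, interaction, conjA_smul, conjA_sum, map_neg, Complex.conj_I, neg_neg]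
  rw [Finset.smul_sum, Finset.smul_sum]
  refine Finset.sum_nbij' (fun r => (-r.1, -r.2)) (fun r => (-r.1, -r.2)) ?_ ?_ ?_ ?_ ?_
  · intro r hr
    simp only [Finset.mem_filter, Finset.mem_product, hP, hQ] at hr ⊢
    exact ⟨hr.1, by rw [← hr.2]; abel⟩
  · intro r hr
    simp only [Finset.mem_filter, Finset.mem_product, hP, hQ] at hr ⊢
    exact ⟨hr.1, by rw [← neg_neg k, ← hr.2]; abel⟩
  · intro r _; simp
  · intro r _; simp
  · intro r _
    simp only [waveDot_conjA, proj_conjA, proj_neg_wave, waveDot_neg_left, map_neg, smul_smul]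
    congr 1
    ring

lemma mem_modes {n : ℕ} {k : Wave d} : k ∈ modes d n ↔ ∀ i, |k i| ≤ n := by
  simp [modes, Pi.le_def, abs_le, forall_and]

lemma neg_mem_modes (n : ℕ) (k : Wave d) : -k ∈ modes d n ↔ k ∈ modes d n := by
  simp [mem_modes]

lemma neg_mem_unresolved (n m : ℕ) (k : Wave d) :
    -k ∈ unresolved d n m ↔ k ∈ unresolved d n m := by
  simp [unresolved, neg_mem_modes]

lemma modes_subset {n m : ℕ} (h : n ≤ m) : modes d n ⊆ modes d m := by
  intro k hk
  rw [mem_modes] at hk ⊢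
  exact fun i => (hk i).trans (by exact_mod_cast h)

lemma tModelField_eq (n m : ℕ) (t : ℝ) (a : Wave d → Amp d) (k : Wave d) :
    tModelField n m t a k = interaction (modes d n) (modes d n) a a k +
      (t : ℂ) • (interaction (modes d n) (unresolved d n m) a
          (interaction (modes d n) (modes d n) a a) k +
        interaction (unresolved d n m) (modes d n)
          (interaction (modes d n) (modes d n) a a) a k) := by
  simp only [tModelField, interaction_smul_left, interaction_smul_right, smul_add, add_assoc]

lemma waveDot_tModelField (n m : ℕ) (t : ℝ) (a : Wave d → Amp d) (k : Wave d) :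
    waveDot k (tModelField n m t a k) = 0 := by
  rw [tModelField_eq, waveDot_add, waveDot_smul, waveDot_add]
  simp [waveDot_interaction]

lemma tModelField_zero_wave (n m : ℕ) (t : ℝ) (a : Wave d → Amp d) :
    tModelField n m t a 0 = 0 := by
  simp [tModelField_eq, interaction_zero_wave]

lemma tModelField_congr {n m : ℕ} (t : ℝ) {a b : Wave d → Amp d}
    (h : ∀ k ∈ modes d n, a k = b k) (k : Wave d) :
    tModelField n m t a k = tModelField n m t b k := by
  have h1 := interaction_congr h h
  rw [tModelField_eq, tModelField_eq, h1, interaction_congr h (fun k _ => h1 k),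
    interaction_congr (fun k _ => h1 k) h]

lemma tModelField_reflect (n m : ℕ) (t : ℝ) (a : Wave d → Amp d) (k : Wave d) :
    tModelField n m t (reflect a) k = reflect (tModelField n m t a) k := by
  have hF := neg_mem_modes (d := d) n
  have hG := neg_mem_unresolved (d := d) n m
  have h1 : interaction (modes d n) (modes d n) (reflect a) (reflect a) =
      reflect (interaction (modes d n) (modes d n) a a) :=
    funext fun k => interaction_reflect hF hF a a k
  rw [tModelField_eq, h1, interaction_reflect hF hG, interaction_reflect hG hF]
  simp only [reflect, tModelField_eq, conjA_add, conjA_smul, Complex.conj_ofReal]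

/-! ### The trilinear form: skew symmetry and bounds -/

/-- Restriction of a family of amplitudes to a set of waves. -/
def cut (P : Finset (Wave d)) (a : Wave d → Amp d) (k : Wave d) : Amp d :=
  if k ∈ P then a k else 0

lemma cut_of_mem {P : Finset (Wave d)} {k : Wave d} (h : k ∈ P) (a : Wave d → Amp d) :
    cut P a k = a k := if_pos h

lemma cut_of_notMem {P : Finset (Wave d)} {k : Wave d} (h : k ∉ P) (a : Wave d → Amp d) :
    cut P a k = 0 := if_neg h

lemma sum_cut_norm_sq {P Λ : Finset (Wave d)} (h : P ⊆ Λ) (a : Wave d → Amp d) :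
    ∑ k ∈ Λ, ‖cut P a k‖ ^ 2 = ∑ k ∈ P, ‖a k‖ ^ 2 := by
  rw [← Finset.sum_subset h fun k _ hk => by rw [cut_of_notMem hk]; simp]
  exact Finset.sum_congr rfl fun k hk => by rw [cut_of_mem hk]

/-- The trilinear form `∑_{p+q+k=0} (q · a_p) (b_q · c_k)`. -/
def tri (Λ : Finset (Wave d)) (a b c : Wave d → Amp d) : ℂ :=
  ∑ p ∈ Λ, ∑ q ∈ Λ, ∑ k ∈ Λ, if p + q + k = 0 then waveDot q (a p) * dotA (b q) (c k) else 0

lemma tri_add_left (Λ : Finset (Wave d)) (a a' b c : Wave d → Amp d) :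
    tri Λ (a + a') b c = tri Λ a b c + tri Λ a' b c := by
  simp only [tri, ← Finset.sum_add_distrib]
  refine Finset.sum_congr rfl fun p _ => Finset.sum_congr rfl fun q _ =>
    Finset.sum_congr rfl fun k _ => ?_
  split_ifs
  · rw [Pi.add_apply, waveDot_add, add_mul]
  · rw [add_zero]

lemma tri_add_mid (Λ : Finset (Wave d)) (a b b' c : Wave d → Amp d) :
    tri Λ a (b + b') c = tri Λ a b c + tri Λ a b' c := by
  simp only [tri, ← Finset.sum_add_distrib]
  refine Finset.sum_congr rfl fun p _ => Finset.sum_congr rfl fun q _ =>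
    Finset.sum_congr rfl fun k _ => ?_
  split_ifs
  · rw [Pi.add_apply, dotA_add_left, mul_add]
  · rw [add_zero]

/-- A transversal field acts skew-symmetrically. -/
lemma tri_antisymm {Λ : Finset (Wave d)} {a : Wave d → Amp d} (ha : ∀ k, waveDot k (a k) = 0)
    (b c : Wave d → Amp d) : tri Λ a b c = -tri Λ a c b := by
  simp only [tri, ← Finset.sum_neg_distrib]
  refine Finset.sum_congr rfl fun p _ => ?_
  rw [Finset.sum_comm]
  refine Finset.sum_congr rfl fun k _ => Finset.sum_congr rfl fun q _ => ?_
  by_cases h : p + q + k = 0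
  · have h' : p + k + q = 0 := by rw [← h]; abel
    -- Since `p·a_p = 0`, this turns `q·a_p` into `-k·a_p`.
    have hq : q = -(p + k) := by rw [eq_neg_iff_add_eq_zero, ← h]; abel
    rw [if_pos h, if_pos h', hq, waveDot_neg_left, waveDot_add_left, ha p, zero_add, dotA_comm,
      neg_mul]
  · have h' : ¬ p + k + q = 0 := fun e => h (by rw [← e]; abel)
    rw [if_neg h, if_neg h', neg_zero]

lemma tri_self {Λ : Finset (Wave d)} {a : Wave d → Amp d} (ha : ∀ k, waveDot k (a k) = 0)
    (b : Wave d → Amp d) : tri Λ a b b = 0 := by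
  have := tri_antisymm (Λ := Λ) ha b b
  linear_combination (1 / 2 : ℂ) * this

lemma interaction_eq_cut {P Q Λ : Finset (Wave d)} (hP : P ⊆ Λ) (hQ : Q ⊆ Λ)
    (a b : Wave d → Amp d) (k : Wave d) :
    interaction P Q a b k = (-Complex.I) • ∑ p ∈ Λ, ∑ q ∈ Λ,
      if p + q = k then waveDot k (cut P a p) • proj k (cut Q b q) else 0 := by
  unfold interaction
  congr 1
  rw [← Finset.sum_product', Finset.sum_filter]
  rw [← Finset.sum_subset (Finset.product_subset_product hP hQ)]
  rotate_left
  · intro r _ hr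
    rw [Finset.mem_product, not_and_or] at hr
    rcases hr with hr | hr
    · rw [cut_of_notMem hr, waveDot_zero_right, zero_smul, ite_self]
    · rw [cut_of_notMem hr, proj_zero_right, smul_zero, ite_self]
  · refine Finset.sum_congr rfl fun r hr => ?_
    rw [Finset.mem_product] at hr
    rw [cut_of_mem hr.1, cut_of_mem hr.2]

/-- Testing an interaction against a transversal field. -/
lemma sum_dotA_interaction {P Q Λ : Finset (Wave d)} (hP : P ⊆ Λ) (hQ : Q ⊆ Λ)
    (hΛ : ∀ k, -k ∈ Λ ↔ k ∈ Λ) {a c : Wave d → Amp d} (ha : ∀ k, waveDot k (cut P a k) = 0)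
    (hc : ∀ k, waveDot k (c k) = 0) (b : Wave d → Amp d) :
    ∑ k ∈ Λ, dotA (interaction P Q a b k) (c (-k)) =
      -Complex.I * tri Λ (cut P a) (cut Q b) c := by
  have h1 : ∀ k, dotA (interaction P Q a b k) (c (-k)) = -Complex.I * ∑ p ∈ Λ, ∑ q ∈ Λ,
      if p + q = k then waveDot q (cut P a p) * dotA (cut Q b q) (c (-k)) else 0 := by
    intro k
    have hk : waveDot k (c (-k)) = 0 := by
      have := hc (-k)
      rwa [waveDot_neg_left, neg_eq_zero] at this
    rw [interaction_eq_cut hP hQ, dotA_smul_left, dotA_sum_left]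
    congr 1
    refine Finset.sum_congr rfl fun p _ => ?_
    rw [dotA_sum_left]
    refine Finset.sum_congr rfl fun q _ => ?_
    split_ifs with h
    -- Transversality of `c` removes the projection, and that of `a` replaces `k·a_p` by `q·a_p`.
    · rw [dotA_smul_left, dotA_proj _ hk, ← h, waveDot_add_left, ha p, zero_add]
    · exact dotA_zero_left _
  simp only [h1, ← Finset.mul_sum, tri]
  congr 1
  have h2 : ∑ k ∈ Λ, ∑ p ∈ Λ, ∑ q ∈ Λ,
      (if p + q = k then waveDot q (cut P a p) * dotA (cut Q b q) (c (-k)) else 0) =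
      ∑ k ∈ Λ, ∑ p ∈ Λ, ∑ q ∈ Λ,
      (if p + q + k = 0 then waveDot q (cut P a p) * dotA (cut Q b q) (c k) else 0) := by
    refine Finset.sum_nbij' (fun k => -k) (fun k => -k) (fun k hk => (hΛ k).2 hk)
      (fun k hk => (hΛ k).2 hk) (fun k _ => neg_neg k) (fun k _ => neg_neg k) fun k _ => ?_
    simp only [add_neg_eq_zero]
  rw [h2, Finset.sum_comm]
  refine Finset.sum_congr rfl fun p _ => ?_
  rw [Finset.sum_comm]

/-- For fixed `q`, each of `p` and `k` determines the other, so Cauchy–Schwarz over the pairs counts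
every index at most once. -/
lemma sum_pairs_le {Λ : Finset (Wave d)} (q : Wave d) (x y : Wave d → ℝ) :
    ∑ p ∈ Λ, ∑ k ∈ Λ, (if p + q + k = 0 then x p * y k else 0) ≤
      √(∑ p ∈ Λ, x p ^ 2) * √(∑ k ∈ Λ, y k ^ 2) := by
  rw [← Finset.sum_product', ← Finset.sum_filter]
  refine (Real.sum_mul_le_sqrt_mul_sqrt _ (fun r : Wave d × Wave d => x r.1)
    (fun r => y r.2)).trans ?_
  gcongr
  · rw [Finset.sum_filter, Finset.sum_product' Λ Λ fun p k => if p + q + k = 0 then x p ^ 2 else 0]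
    refine Finset.sum_le_sum fun p _ => ?_
    have : ∀ k, p + q + k = 0 ↔ -(p + q) = k := fun k => by rw [neg_eq_iff_add_eq_zero]
    simp only [this, Finset.sum_ite_eq]
    split_ifs
    · exact le_rfl
    · positivity
  · rw [Finset.sum_filter,
      Finset.sum_product_right' Λ Λ fun p k => if p + q + k = 0 then y k ^ 2 else 0]
    refine Finset.sum_le_sum fun k _ => ?_
    have : ∀ p, p + q + k = 0 ↔ -(q + k) = p := fun p => by
      rw [neg_eq_iff_add_eq_zero, add_comm (q + k), add_assoc]
    simp only [this, Finset.sum_ite_eq]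
    split_ifs
    · exact le_rfl
    · positivity

/-- The middle argument carries the derivative and is measured in `ℓ¹`, the other two in `ℓ²`. In
the energy estimate the middle argument is always the exact solution. -/
lemma norm_tri_le (Λ : Finset (Wave d)) (a b c : Wave d → Amp d) :
    ‖tri Λ a b c‖ ≤ (∑ q ∈ Λ, √(waveSq q) * ‖b q‖) *
      (√(∑ k ∈ Λ, ‖a k‖ ^ 2) * √(∑ k ∈ Λ, ‖c k‖ ^ 2)) := by
  unfold tri
  rw [Finset.sum_comm, Finset.sum_mul]
  refine (norm_sum_le _ _).trans (Finset.sum_le_sum fun q _ => ?_)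
  refine le_trans ?_ (mul_le_mul_of_nonneg_left
    (sum_pairs_le (Λ := Λ) q (fun p => ‖a p‖) (fun k => ‖c k‖)) (by positivity))
  rw [Finset.mul_sum]
  refine (norm_sum_le _ _).trans (Finset.sum_le_sum fun p _ => ?_)
  rw [Finset.mul_sum]
  refine (norm_sum_le _ _).trans (Finset.sum_le_sum fun k _ => ?_)
  split_ifs
  · rw [norm_mul]
    calc ‖waveDot q (a p)‖ * ‖dotA (b q) (c k)‖
        ≤ (√(waveSq q) * ‖a p‖) * (‖b q‖ * ‖c k‖) := by
          gcongr
          · exact norm_waveDot_le _ _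
          · exact norm_dotA_le _ _
      _ = √(waveSq q) * ‖b q‖ * (‖a p‖ * ‖c k‖) := by ring
  · simp

/-! ### The energy estimate -/

lemma dotA_sub_left (x y z : Amp d) : dotA (x - y) z = dotA x z - dotA y z := by
  simp [dotA, sub_mul, Finset.sum_sub_distrib]

lemma waveDot_sub (k : Wave d) (y z : Amp d) : waveDot k (y - z) = waveDot k y - waveDot k z := by
  simp [waveDot, mul_sub, Finset.sum_sub_distrib]

lemma waveDot_cut {P : Finset (Wave d)} {a : Wave d → Amp d} (h : ∀ k ∈ P, waveDot k (a k) = 0)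
    (k : Wave d) : waveDot k (cut P a k) = 0 := by
  by_cases hk : k ∈ P
  · rw [cut_of_mem hk, h k hk]
  · rw [cut_of_notMem hk, waveDot_zero_right]

/-- On the support of a real field the bilinear pairing is the inner product. -/
lemma dotA_cut_neg {P : Finset (Wave d)} (hP : ∀ k, -k ∈ P ↔ k ∈ P) {a : Wave d → Amp d}
    (ha : ∀ k ∈ P, reflect a k = a k) {k : Wave d} (hk : k ∈ P) (y : Amp d) :
    dotA y (cut P a (-k)) = inner ℂ (a k) y := by
  have h := ha (-k) ((hP k).2 hk)
  rw [reflect, neg_neg] at h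
  rw [cut_of_mem ((hP k).2 hk), ← h, dotA_conjA]

lemma sum_dotA_cut {P Λ : Finset (Wave d)} (hPΛ : P ⊆ Λ) (hP : ∀ k, -k ∈ P ↔ k ∈ P)
    {a : Wave d → Amp d} (ha : ∀ k ∈ P, reflect a k = a k) (X : Wave d → Amp d) :
    ∑ k ∈ Λ, dotA (X k) (cut P a (-k)) = ∑ k ∈ P, inner ℂ (a k) (X k) := by
  rw [← Finset.sum_subset hPΛ]
  · exact Finset.sum_congr rfl fun k hk => dotA_cut_neg hP ha hk _
  · intro k _ hk
    rw [cut_of_notMem (fun h => hk ((hP k).1 h)), dotA_zero_right]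

lemma norm_sum_inner_le (P : Finset (Wave d)) (a X : Wave d → Amp d) :
    ‖∑ k ∈ P, inner ℂ (a k) (X k)‖ ≤ √(∑ k ∈ P, ‖X k‖ ^ 2) * √(∑ k ∈ P, ‖a k‖ ^ 2) := by
  refine (norm_sum_le _ _).trans (le_trans (Finset.sum_le_sum fun k _ => ?_)
    (Real.sum_mul_le_sqrt_mul_sqrt _ _ _))
  rw [mul_comm]
  exact norm_inner_le_norm _ _

lemma reflect_sub (a b : Wave d → Amp d) (k : Wave d) :
    reflect (a - b) k = reflect a k - reflect b k := by
  simp [reflect, conjA_sub]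

lemma sum_cut_wave {P Λ : Finset (Wave d)} (h : P ⊆ Λ) (a : Wave d → Amp d) :
    ∑ q ∈ Λ, √(waveSq q) * ‖cut P a q‖ = ∑ q ∈ P, √(waveSq q) * ‖a q‖ := by
  rw [← Finset.sum_subset h fun k _ hk => by rw [cut_of_notMem hk]; simp]
  exact Finset.sum_congr rfl fun k hk => by rw [cut_of_mem hk]

/-- Half of `-t y²` absorbs `t H y`, the other half `2 t L x y`. -/
lemma quadratic_absorption {t L H x y : ℝ} (ht : 0 ≤ t) :
    L * x ^ 2 + H * x + t * (H * y + 2 * (L * x * y) - y ^ 2) ≤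
      (L + 2 * t * L ^ 2 + 1 / 2) * x ^ 2 + (t + 1) / 2 * H ^ 2 := by
  have h1 := sq_nonneg (H - x)
  have h2 := mul_nonneg ht (sq_nonneg (H - y))
  have h3 := mul_nonneg ht (sq_nonneg (2 * L * x - y))
  linarith [h1, h2, h3]

/-- The energy estimate for the difference `W - V` of the resolved part `W` of an exact solution
(with residual `R`) and a solution `V` of the `t`-model. -/
lemma energy_estimate {n m : ℕ} (hnm : n ≤ m) {t : ℝ} (ht : 0 ≤ t) {W V R : Wave d → Amp d}
    (hWd : ∀ k ∈ modes d n, waveDot k (W k) = 0) (hVd : ∀ k ∈ modes d n, waveDot k (V k) = 0)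
    (hWr : ∀ k ∈ modes d n, reflect W k = W k) (hVr : ∀ k ∈ modes d n, reflect V k = V k)
    {L H : ℝ} (hL : ∑ q ∈ modes d n, √(waveSq q) * ‖W q‖ ≤ L) (hH : 0 ≤ H)
    (hR : ∑ k ∈ modes d n, ‖R k‖ ^ 2 ≤ H ^ 2)
    (hG : ∑ k ∈ unresolved d n m, ‖interaction (modes d n) (modes d n) W W k‖ ^ 2 ≤ H ^ 2) :
    (∑ k ∈ modes d n, inner ℂ (W k - V k) (interaction (modes d n) (modes d n) W W k + R k -
      tModelField n m t V k)).re ≤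
      (L + 2 * t * L ^ 2 + 1 / 2) * ∑ k ∈ modes d n, ‖W k - V k‖ ^ 2 + (t + 1) / 2 * H ^ 2 := by
  set F := modes d n with hF
  set G := unresolved d n m with hGdef
  -- One symmetric set containing `F` and `G`: fields extended by zero to it can all enter the same
  -- trilinear form.
  set Λ := modes d m
  have hFΛ : F ⊆ Λ := modes_subset hnm
  have hGΛ : G ⊆ Λ := Finset.sdiff_subset
  have hFn := neg_mem_modes (d := d) n
  have hGn := neg_mem_unresolved (d := d) n m
  have hΛn := neg_mem_modes (d := d) m
  set g₀ := interaction F F V V with hg₀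
  set w := cut F W
  set v := cut F V
  set g := cut G g₀
  set e := cut F (W - V) with he
  have hw : w = v + e := by
    ext1 k
    by_cases hk : k ∈ F
    · simp [w, v, e, cut_of_mem hk]
    · simp [w, v, e, cut_of_notMem hk]
  have hwd : ∀ k, waveDot k (w k) = 0 := waveDot_cut hWd
  have hvd : ∀ k, waveDot k (v k) = 0 := waveDot_cut hVd
  have hed : ∀ k, waveDot k (e k) = 0 := waveDot_cut fun k hk => by
    rw [Pi.sub_apply, waveDot_sub, hWd k hk, hVd k hk, sub_zero]
  have hgd : ∀ k, waveDot k (g k) = 0 := waveDot_cut fun k _ => waveDot_interaction _ _ _ _ _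
  have her : ∀ k ∈ F, reflect (W - V) k = (W - V) k := fun k hk => by
    rw [reflect_sub, hWr k hk, hVr k hk, Pi.sub_apply]
  have hgr : ∀ k ∈ G, reflect g₀ k = g₀ k := fun k _ => by
    rw [hg₀, ← interaction_reflect hFn hFn]
    exact interaction_congr hVr hVr k
  have hsplit : ∑ k ∈ F, inner ℂ (W k - V k) (interaction F F W W k + R k -
      tModelField n m t V k) = -Complex.I * tri Λ w w e + ∑ k ∈ F, inner ℂ (W k - V k) (R k)
        - (-Complex.I * tri Λ v v e + (t : ℂ) * (-Complex.I * tri Λ v g e +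
          -Complex.I * tri Λ g v e)) := by
    have h1 := sum_dotA_cut hFΛ hFn her (fun k => interaction F F W W k + R k -
      tModelField n m t V k)
    have h2 := sum_dotA_cut hFΛ hFn her R
    simp only [Pi.sub_apply] at h1 h2
    rw [← h1, ← h2, ← he, ← sum_dotA_interaction hFΛ hFΛ hΛn hwd hed W,
      ← sum_dotA_interaction hFΛ hFΛ hΛn hvd hed V, ← sum_dotA_interaction hFΛ hGΛ hΛn hvd hed g₀,
      ← sum_dotA_interaction hGΛ hFΛ hΛn hgd hed V, ← Finset.sum_add_distrib,
      ← Finset.sum_add_distrib, Finset.mul_sum, ← Finset.sum_add_distrib,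
      ← Finset.sum_sub_distrib]
    refine Finset.sum_congr rfl fun k _ => ?_
    rw [tModelField_eq, dotA_sub_left, dotA_add_left, dotA_add_left, dotA_smul_left, dotA_add_left]
  -- The source of dissipation: `g₀` is itself the interaction of `v` with itself, and reality turns
  -- the bilinear pairing into a squared norm.
  have hvvg : -Complex.I * tri Λ v v g = ((∑ k ∈ G, ‖g₀ k‖ ^ 2 : ℝ) : ℂ) := by
    rw [← sum_dotA_interaction hFΛ hFΛ hΛn hvd hgd V, sum_dotA_cut hGΛ hGn hgr]
    push_cast
    exact Finset.sum_congr rfl fun k _ => inner_self_eq_norm_sq_to_K _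
  have hwwg : -Complex.I * tri Λ w w g = ∑ k ∈ G, inner ℂ (g₀ k) (interaction F F W W k) := by
    rw [← sum_dotA_interaction hFΛ hFΛ hΛn hwd hgd W, sum_dotA_cut hGΛ hGn hgr]
  -- The next three identities substitute `w = v + e` and use skew symmetry, so that every term left
  -- to be bounded carries its derivative on `w` or is `tri Λ w w g`, which is small by `hG`.
  have e1 : tri Λ w w e - tri Λ v v e = tri Λ e w e := by
    have : tri Λ w w e = tri Λ v w e + tri Λ e w e := by
      conv_lhs => rw [hw, tri_add_left, ← hw]
    rw [this, hw, tri_add_mid, tri_self hvd]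
    ring
  have e2 : tri Λ g v e = tri Λ g w e := by
    rw [hw, tri_add_mid, tri_self hgd, add_zero]
  have e3 : tri Λ v g e = tri Λ v v g - tri Λ w w g + tri Λ e w g := by
    have h1 : tri Λ w w g = tri Λ v w g + tri Λ e w g := by
      conv_lhs => rw [hw, tri_add_left, ← hw]
    have h2 : tri Λ v w g = tri Λ v v g + tri Λ v e g := by rw [hw, tri_add_mid]
    rw [h1, h2, tri_antisymm hvd g e]
    ring
  obtain ⟨x, hx⟩ : ∃ x, x = √(∑ k ∈ F, ‖W k - V k‖ ^ 2) := ⟨_, rfl⟩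
  obtain ⟨y, hy⟩ : ∃ y, y = √(∑ k ∈ G, ‖g₀ k‖ ^ 2) := ⟨_, rfl⟩
  have hx0 : 0 ≤ x := hx ▸ Real.sqrt_nonneg _
  have hy0 : 0 ≤ y := hy ▸ Real.sqrt_nonneg _
  have hxsq : x ^ 2 = ∑ k ∈ F, ‖W k - V k‖ ^ 2 := by rw [hx, Real.sq_sqrt (by positivity)]
  have hysq : y ^ 2 = ∑ k ∈ G, ‖g₀ k‖ ^ 2 := by rw [hy, Real.sq_sqrt (by positivity)]
  have hex : √(∑ k ∈ Λ, ‖e k‖ ^ 2) = x := by rw [he, sum_cut_norm_sq hFΛ, hx]; rfl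
  have hgy : √(∑ k ∈ Λ, ‖g k‖ ^ 2) = y := by rw [sum_cut_norm_sq hGΛ, hy]
  have hwL : ∑ q ∈ Λ, √(waveSq q) * ‖w q‖ ≤ L := by rwa [sum_cut_wave hFΛ]
  have b1 : ‖tri Λ e w e‖ ≤ L * x ^ 2 := by
    refine (norm_tri_le Λ e w e).trans ?_
    rw [hex, ← pow_two]
    exact mul_le_mul_of_nonneg_right hwL (sq_nonneg x)
  have b2 : ‖tri Λ e w g‖ ≤ L * (x * y) := by
    refine (norm_tri_le Λ e w g).trans ?_
    rw [hex, hgy]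
    exact mul_le_mul_of_nonneg_right hwL (mul_nonneg hx0 hy0)
  have b3 : ‖tri Λ g w e‖ ≤ L * (x * y) := by
    refine (norm_tri_le Λ g w e).trans ?_
    rw [hex, hgy, mul_comm y x]
    exact mul_le_mul_of_nonneg_right hwL (mul_nonneg hx0 hy0)
  have b4 : ‖∑ k ∈ F, inner ℂ (W k - V k) (R k)‖ ≤ H * x := by
    refine (norm_sum_inner_le F (fun k => W k - V k) R).trans ?_
    rw [← hx]
    exact mul_le_mul_of_nonneg_right ((Real.sqrt_le_left hH).2 hR) hx0
  have b5 : ‖-Complex.I * tri Λ w w g‖ ≤ H * y := by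
    rw [hwwg]
    refine (norm_sum_inner_le G g₀ _).trans ?_
    rw [← hy]
    exact mul_le_mul_of_nonneg_right ((Real.sqrt_le_left hH).2 hG) hy0
  have hfin : ∑ k ∈ F, inner ℂ (W k - V k) (interaction F F W W k + R k -
      tModelField n m t V k) = -Complex.I * tri Λ e w e + ∑ k ∈ F, inner ℂ (W k - V k) (R k)
        + (t : ℂ) * (-Complex.I * tri Λ w w g + Complex.I * tri Λ e w g +
          Complex.I * tri Λ g w e - ((y ^ 2 : ℝ) : ℂ)) := by
    rw [hsplit, hysq, ← hvvg, e2, e3, ← e1]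
    ring
  rw [hfin, ← hxsq]
  have r1 := (Complex.re_le_norm (-Complex.I * tri Λ e w e)).trans
    (by simpa using b1 : ‖-Complex.I * tri Λ e w e‖ ≤ L * x ^ 2)
  have r2 := (Complex.re_le_norm (Complex.I * tri Λ e w g)).trans
    (by simpa using b2 : ‖Complex.I * tri Λ e w g‖ ≤ L * (x * y))
  have r3 := (Complex.re_le_norm (Complex.I * tri Λ g w e)).trans
    (by simpa using b3 : ‖Complex.I * tri Λ g w e‖ ≤ L * (x * y))
  have r4 := (Complex.re_le_norm _).trans b4
  have r5 := (Complex.re_le_norm _).trans b5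
  refine le_trans ?_ (quadratic_absorption (L := L) (H := H) (x := x) (y := y) ht)
  rw [Complex.add_re, Complex.add_re, Complex.re_ofReal_mul, Complex.sub_re, Complex.add_re,
    Complex.add_re, Complex.ofReal_re]
  have := mul_le_mul_of_nonneg_left (add_le_add (add_le_add r5 r2) r3) ht
  nlinarith [this]

/-! ### Transversality and reality of `t`-model solutions -/

/-- `conjA` as a continuous real-linear map. -/
def conjL : Amp d →L[ℝ] Amp d :=
  LinearMap.toContinuousLinearMap
    { toFun := conjA
      map_add' := conjA_add
      map_smul' := fun c z => by
        ext i; simp [conjA] }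

lemma contDiff_interaction {Z : Type*} [NormedAddCommGroup Z] [NormedSpace ℝ Z]
    (P Q : Finset (Wave d)) {a b : Z → Wave d → Amp d}
    (ha : ∀ k, ContDiff ℝ 1 fun z => a z k) (hb : ∀ k, ContDiff ℝ 1 fun z => b z k) (k : Wave d) :
    ContDiff ℝ 1 fun z => interaction P Q (a z) (b z) k := by
  unfold interaction
  refine ContDiff.const_smul _ (ContDiff.sum fun r _ => ContDiff.fun_smul ?_ ?_)
  · refine ContDiff.sum fun i _ => contDiff_const.mul ?_
    exact ((EuclideanSpace.proj (𝕜 := ℂ) i : Amp d →L[ℂ] ℂ).restrictScalars ℝ).contDiff.comp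
      (ha r.1)
  · exact ((LinearMap.toContinuousLinearMap (projL k)).restrictScalars ℝ).contDiff.comp (hb r.2)

lemma contDiff_tModelField {Z : Type*} [NormedAddCommGroup Z] [NormedSpace ℝ Z] (n m : ℕ)
    {τ : Z → ℝ} {a : Z → Wave d → Amp d} (hτ : ContDiff ℝ 1 τ)
    (ha : ∀ k, ContDiff ℝ 1 fun z => a z k) (k : Wave d) :
    ContDiff ℝ 1 fun z => tModelField n m (τ z) (a z) k := by
  simp only [tModelField_eq]
  have h1 := contDiff_interaction (modes d n) (modes d n) ha ha
  exact (h1 k).add ((Complex.ofRealCLM.contDiff.comp hτ).smul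
    ((contDiff_interaction _ _ ha h1 k).add (contDiff_interaction _ _ h1 ha k)))

/-- Extension of finitely many amplitudes by zero. -/
def extend (n : ℕ) (a : modes d n → Amp d) (k : Wave d) : Amp d :=
  if h : k ∈ modes d n then a ⟨k, h⟩ else 0

lemma extend_apply {n : ℕ} {q : Wave d} (hq : q ∈ modes d n) (a : modes d n → Amp d) :
    extend n a q = a ⟨q, hq⟩ := dif_pos hq

/-- The field is a real polynomial in time and finitely many amplitudes and conjugation-free; `C¹`
regularity supplies the Lipschitz bound for ODE uniqueness. -/
lemma contDiff_tModelField_extend (n m : ℕ) :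
    ContDiff ℝ 1 fun (z : ℝ × (modes d n → Amp d)) (k : modes d n) =>
      tModelField n m z.1 (extend n z.2) k := by
  have h : ∀ q, ContDiff ℝ 1 fun z : ℝ × (modes d n → Amp d) => extend n z.2 q := by
    intro q
    by_cases hq : q ∈ modes d n
    · simp only [extend, dif_pos hq]
      exact (contDiff_apply ℝ (Amp d) (⟨q, hq⟩ : modes d n)).comp contDiff_snd
    · simp only [extend, dif_neg hq]
      exact contDiff_const
  exact contDiff_pi.2 fun k => contDiff_tModelField n m contDiff_fst h k.1

namespace IsTModelSolution

variable {n m : ℕ} {T : ℝ} {a : Wave d → Amp d} {v : ℝ → Wave d → Amp d}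

/-- The zero mode fits the same equation, because the field vanishes at `k = 0`. -/
lemma hasDerivWithinAt (h : IsTModelSolution n m T a v) {t : ℝ} (ht : t ∈ Icc 0 T) {k : Wave d}
    (hk : k ∈ modes d n) :
    HasDerivWithinAt (fun τ => v τ k) (tModelField n m t (v t) k) (Icc 0 T) t := by
  by_cases h0 : k = 0
  · subst h0
    rw [tModelField_zero_wave]
    exact (hasDerivWithinAt_const t _ (0 : Amp d)).congr (fun τ hτ => h.zero_mode τ hτ)
      (h.zero_mode t ht)
  · exact h.evolution t ht k hk h0

/-- The field is transversal, so `k·v_k` is constant in time. -/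
lemma waveDot_eq_zero (h : IsTModelSolution n m T a v) (ha : ∀ k, waveDot k (a k) = 0) {t : ℝ}
    (ht : t ∈ Icc 0 T) {k : Wave d} (hk : k ∈ modes d n) : waveDot k (v t k) = 0 := by
  have hd : ∀ τ ∈ Icc 0 T, HasDerivWithinAt (fun τ => waveDot k (v τ k)) 0 (Icc 0 T) τ := by
    intro τ hτ
    have h2 : ∀ i, HasDerivWithinAt (fun τ => v τ k i) (tModelField n m τ (v τ) k i)
        (Icc 0 T) τ := fun i =>
      ((EuclideanSpace.proj (𝕜 := ℂ) i : Amp d →L[ℂ] ℂ).restrictScalars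
        ℝ).hasFDerivAt.comp_hasDerivWithinAt τ (h.hasDerivWithinAt hτ hk)
    have h3 := HasDerivWithinAt.fun_sum fun i (_ : i ∈ Finset.univ) => (h2 i).const_mul (k i : ℂ)
    have h4 := waveDot_tModelField n m τ (v τ) k
    rw [waveDot] at h4
    rw [h4] at h3
    exact h3
  have := constant_of_has_deriv_right_zero (fun τ hτ => (hd τ hτ).continuousWithinAt)
    (fun τ hτ => (hd τ (Ico_subset_Icc_self hτ)).mono_of_mem_nhdsWithin
      (Icc_mem_nhdsGE_of_mem hτ)) t ht
  rw [this, h.initial k hk, ha k]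

/-- A solution of the `t`-model with real initial data is real. -/
lemma reflect_eq (h : IsTModelSolution n m T a v) (ha : ∀ k, reflect a k = a k) {t : ℝ}
    (ht : t ∈ Icc 0 T) {k : Wave d} (hk : k ∈ modes d n) : reflect (v t) k = v t k := by
  let E := modes d n → Amp d
  let Φ : ℝ × E → E := fun z k => tModelField n m z.1 (extend n z.2) k
  have hΦ : ContDiff ℝ 1 Φ := contDiff_tModelField_extend n m
  let f : ℝ → E := fun τ k => v τ k
  let f' : ℝ → E := fun τ k => reflect (v τ) k
  have hfd : ∀ τ ∈ Icc 0 T, HasDerivWithinAt f (Φ (τ, f τ)) (Icc 0 T) τ := by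
    intro τ hτ
    refine hasDerivWithinAt_pi.2 fun k => ?_
    change HasDerivWithinAt (fun τ => v τ k.1) (tModelField n m τ (extend n (f τ)) k.1) _ _
    rw [tModelField_congr τ (fun q hq => extend_apply hq (f τ)) (b := v τ)]
    exact h.hasDerivWithinAt hτ k.2
  -- The field commutes with conjugate reflection, so the reflected solution solves the same
  -- equation; uniqueness identifies the two.
  have hfd' : ∀ τ ∈ Icc 0 T, HasDerivWithinAt f' (Φ (τ, f' τ)) (Icc 0 T) τ := by
    intro τ hτ
    refine hasDerivWithinAt_pi.2 fun k => ?_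
    change HasDerivWithinAt (fun τ => conjA (v τ (-k.1)))
      (tModelField n m τ (extend n (f' τ)) k.1) _ _
    rw [tModelField_congr τ (fun q hq => extend_apply hq (f' τ)) (b := reflect (v τ)),
      tModelField_reflect]
    exact conjL.hasFDerivAt.comp_hasDerivWithinAt τ
      (h.hasDerivWithinAt hτ ((neg_mem_modes n k.1).2 k.2))
  have hfc : ContinuousOn f (Icc 0 T) := fun τ hτ => (hfd τ hτ).continuousWithinAt
  have hfc' : ContinuousOn f' (Icc 0 T) := fun τ hτ => (hfd' τ hτ).continuousWithinAt
  -- The field is not globally Lipschitz, but a uniform constant exists on the compact union of both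
  -- trajectories.
  have hK : IsCompact (Icc 0 T ×ˢ (f '' Icc 0 T ∪ f' '' Icc 0 T)) :=
    isCompact_Icc.prod ((isCompact_Icc.image_of_continuousOn hfc).union
      (isCompact_Icc.image_of_continuousOn hfc'))
  obtain ⟨K, hKL⟩ := (hΦ.locallyLipschitz.locallyLipschitzOn
    (s := Icc 0 T ×ˢ (f '' Icc 0 T ∪ f' '' Icc 0 T))).exists_lipschitzOnWith_of_compact hK
  have hlip : ∀ τ ∈ Ico 0 T, LipschitzOnWith K (fun b => Φ (τ, b))
      (f '' Icc 0 T ∪ f' '' Icc 0 T) := by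
    intro τ hτ b hb c hc
    have := hKL (x := (τ, b)) ⟨Ico_subset_Icc_self hτ, hb⟩ (y := (τ, c))
      ⟨Ico_subset_Icc_self hτ, hc⟩
    simpa [Prod.edist_eq] using this
  have hT : (0 : ℝ) ∈ Icc 0 T := ⟨le_rfl, ht.1.trans ht.2⟩
  have heq : EqOn f' f (Icc 0 T) :=
    ODE_solution_unique_of_mem_Icc_right (v := fun τ b => Φ (τ, b))
      (s := fun _ => f '' Icc 0 T ∪ f' '' Icc 0 T) hlip hfc'
      (fun τ hτ => (hfd' τ (Ico_subset_Icc_self hτ)).mono_of_mem_nhdsWithin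
        (Icc_mem_nhdsGE_of_mem hτ))
      (fun τ hτ => Or.inr (mem_image_of_mem _ (Ico_subset_Icc_self hτ))) hfc
      (fun τ hτ => (hfd τ (Ico_subset_Icc_self hτ)).mono_of_mem_nhdsWithin
        (Icc_mem_nhdsGE_of_mem hτ))
      (fun τ hτ => Or.inl (mem_image_of_mem _ (Ico_subset_Icc_self hτ)))
      (by
        funext k
        change conjA (v 0 (-k.1)) = v 0 k
        rw [h.initial _ ((neg_mem_modes n k.1).2 k.2), h.initial _ k.2]
        exact ha k)
  exact congrFun (heq ht) ⟨k, hk⟩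

end IsTModelSolution

/-! ### Weighted amplitudes in `ℓ¹` and `ℓ²` -/

/-- The Cauchy-Schwarz inequality for series in `ℝ≥0∞`. -/
lemma ennreal_tsum_mul_sq_le {ι : Type*} (x y : ι → ℝ≥0∞) :
    (∑' i, x i * y i) ^ 2 ≤ (∑' i, x i ^ 2) * ∑' i, y i ^ 2 := by
  let _ : MeasurableSpace ι := ⊤
  have h := ENNReal.lintegral_mul_le_Lp_mul_Lq (Measure.count : Measure ι)
    Real.HolderConjugate.two_two (f := x) (g := y) measurable_from_top.aemeasurable
    measurable_from_top.aemeasurable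
  simp only [lintegral_count, Pi.mul_apply, ENNReal.rpow_two] at h
  calc (∑' i, x i * y i) ^ 2
      ≤ ((∑' i, x i ^ 2) ^ (1 / 2 : ℝ) * (∑' i, y i ^ 2) ^ (1 / 2 : ℝ)) ^ 2 := by gcongr
    _ = _ := by
      rw [mul_pow, ← ENNReal.rpow_two, ← ENNReal.rpow_two, ← ENNReal.rpow_mul, ← ENNReal.rpow_mul]
      norm_num

lemma ennreal_sqrt_sq (x : ℝ≥0∞) : (x ^ (1 / 2 : ℝ)) ^ 2 = x := by
  rw [← ENNReal.rpow_two, ← ENNReal.rpow_mul]; norm_num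

/-- Young's inequality `ℓ¹ * ℓ² ⊆ ℓ²`. -/
lemma ennreal_young {A : Type*} [AddCommGroup A] (x y : A → ℝ≥0∞) :
    ∑' k, (∑' p, x p * y (k - p)) ^ 2 ≤ (∑' p, x p) ^ 2 * ∑' q, y q ^ 2 := by
  have h1 : ∀ k, (∑' p, x p * y (k - p)) ^ 2 ≤ (∑' p, x p) * ∑' p, x p * y (k - p) ^ 2 := by
    intro k
    -- Cauchy–Schwarz after splitting `x = x^{1/2} x^{1/2}`.
    have h := ennreal_tsum_mul_sq_le (fun p => x p ^ (1 / 2 : ℝ))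
      (fun p => x p ^ (1 / 2 : ℝ) * y (k - p))
    simp only [mul_pow, ennreal_sqrt_sq, ← mul_assoc] at h
    simpa only [← pow_two, ennreal_sqrt_sq] using h
  calc ∑' k, (∑' p, x p * y (k - p)) ^ 2
      ≤ ∑' k, (∑' p, x p) * ∑' p, x p * y (k - p) ^ 2 := ENNReal.tsum_le_tsum h1
    _ = (∑' p, x p) * ∑' p, x p * ∑' q, y q ^ 2 := by
        rw [ENNReal.tsum_mul_left, ENNReal.tsum_comm]
        congr 1
        refine tsum_congr fun p => ?_
        rw [ENNReal.tsum_mul_left]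
        congr 1
        exact (Equiv.subRight p).tsum_eq fun q => y q ^ 2
    _ = _ := by rw [ENNReal.tsum_mul_right, ← mul_assoc, pow_two]

/-- The amplitude `(1+|k|²)^{1/2} |a_k|`. -/
def weighted (a : Wave d → Amp d) (k : Wave d) : ℝ≥0∞ := ENNReal.ofReal (√(1 + waveSq k) * ‖a k‖)

lemma weighted_sq (a : Wave d → Amp d) (k : Wave d) :
    weighted a k ^ 2 = ENNReal.ofReal (1 + waveSq k) * ‖a k‖ₑ ^ 2 := by
  have := waveSq_nonneg k
  rw [weighted, ENNReal.ofReal_mul (Real.sqrt_nonneg _), ofReal_norm, mul_pow,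
    ← ENNReal.ofReal_pow (Real.sqrt_nonneg _), Real.sq_sqrt (by positivity)]

lemma enorm_le_weighted (a : Wave d → Amp d) (k : Wave d) : ‖a k‖ₑ ≤ weighted a k := by
  rw [weighted, ← ofReal_norm]
  refine ENNReal.ofReal_le_ofReal ?_
  have h : 1 ≤ √(1 + waveSq k) := by
    rw [Real.one_le_sqrt]; linarith [waveSq_nonneg k]
  nlinarith [norm_nonneg (a k)]

/-- The squared Sobolev norm of a family of amplitudes, without the factor `(2π)^d`. -/
def sobolevSum (s : ℝ) (a : Wave d → Amp d) : ℝ≥0∞ :=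
  ∑' k, ENNReal.ofReal ((1 + waveSq k) ^ s) * ‖a k‖ₑ ^ 2

/-- The embedding constant `∑ (1+|k|²)^{-2}`. -/
def latticeSum (d : ℕ) : ℝ≥0∞ := ∑' k : Wave d, ENNReal.ofReal (((1 + waveSq k) ^ 2)⁻¹)

/-- Cauchy–Schwarz with the splitting `(1+|k|²)^{1/2} = (1+|k|²)^{-1} (1+|k|²)^{3/2}`. -/
lemma tsum_weighted_sq_le (a : Wave d → Amp d) :
    (∑' k, weighted a k) ^ 2 ≤ latticeSum d * sobolevSum 3 a := by
  have h := ennreal_tsum_mul_sq_le (fun k : Wave d => ENNReal.ofReal ((1 + waveSq k)⁻¹))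
    (fun k => ENNReal.ofReal ((1 + waveSq k) ^ (3 / 2 : ℝ)) * ‖a k‖ₑ)
  have e1 : ∀ k : Wave d, weighted a k = ENNReal.ofReal ((1 + waveSq k)⁻¹) *
      (ENNReal.ofReal ((1 + waveSq k) ^ (3 / 2 : ℝ)) * ‖a k‖ₑ) := by
    intro k
    have hk : 0 < 1 + waveSq k := by linarith [waveSq_nonneg k]
    rw [weighted, ← mul_assoc, ← ENNReal.ofReal_mul (by positivity),
      ENNReal.ofReal_mul (by positivity), ofReal_norm]
    congr 2
    rw [← Real.rpow_neg_one, ← Real.rpow_add hk, Real.sqrt_eq_rpow]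
    norm_num
  have e2 : ∀ k : Wave d, (ENNReal.ofReal ((1 + waveSq k)⁻¹)) ^ 2 =
      ENNReal.ofReal (((1 + waveSq k) ^ 2)⁻¹) := by
    intro k
    have hk : 0 < 1 + waveSq k := by linarith [waveSq_nonneg k]
    rw [← ENNReal.ofReal_pow (by positivity), inv_pow]
  have e3 : ∀ k : Wave d, (ENNReal.ofReal ((1 + waveSq k) ^ (3 / 2 : ℝ)) * ‖a k‖ₑ) ^ 2 =
      ENNReal.ofReal ((1 + waveSq k) ^ (3 : ℝ)) * ‖a k‖ₑ ^ 2 := by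
    intro k
    have hk : 0 < 1 + waveSq k := by linarith [waveSq_nonneg k]
    rw [mul_pow, ← ENNReal.ofReal_pow (by positivity), ← Real.rpow_natCast, ← Real.rpow_mul hk.le]
    norm_num
  simp only [← e1, e2, e3] at h
  exact h

/-- The high-frequency part of the weighted amplitudes. -/
def tailWeighted (N : ℕ) (a : Wave d → Amp d) (k : Wave d) : ℝ≥0∞ :=
  if k ∈ modes d N then 0 else weighted a k

lemma sq_le_waveSq_of_notMem {N : ℕ} {k : Wave d} (h : k ∉ modes d N) :
    ((N : ℝ) + 1) ^ 2 ≤ waveSq k := by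
  rw [mem_modes] at h
  push Not at h
  obtain ⟨i, hi⟩ := h
  have h1 : ((N : ℝ) + 1) ≤ |((k i : ℤ) : ℝ)| := by exact_mod_cast hi
  calc ((N : ℝ) + 1) ^ 2 ≤ |((k i : ℤ) : ℝ)| ^ 2 := by gcongr
    _ = ((k i : ℤ) : ℝ) ^ 2 := sq_abs _
    _ ≤ waveSq k := Finset.single_le_sum (f := fun i => ((k i : ℤ) : ℝ) ^ 2)
        (fun _ _ => sq_nonneg _) (Finset.mem_univ i)

lemma tsum_tailWeighted_sq_le {n : ℕ} (hn : 1 ≤ n) {s : ℝ} (hs : 1 ≤ s) (a : Wave d → Amp d) :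
    ∑' k, tailWeighted (n / 2) a k ^ 2 ≤
      ENNReal.ofReal (((n : ℝ) / 2) ^ (2 * (1 - s))) * sobolevSum s a := by
  rw [sobolevSum, ← ENNReal.tsum_mul_left]
  refine ENNReal.tsum_le_tsum fun k => ?_
  unfold tailWeighted
  split_ifs with h
  · simp
  · have hk : 0 < 1 + waveSq k := by linarith [waveSq_nonneg k]
    have hn' : (0 : ℝ) < (n : ℝ) / 2 := by positivity
    rw [weighted_sq, ← mul_assoc, ← ENNReal.ofReal_mul (by positivity)]
    gcongr
    have h1 : ((n : ℝ) / 2) ^ 2 ≤ 1 + waveSq k := by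
      have h2 := sq_le_waveSq_of_notMem h
      -- Integer division rounds down; the `+ 1` gained outside the cube of half-width `n / 2` makes
      -- up for it.
      have h3 : (n : ℝ) / 2 ≤ ((n / 2 : ℕ) : ℝ) + 1 := by
        have : n ≤ 2 * (n / 2) + 1 := by omega
        have : (n : ℝ) ≤ 2 * ((n / 2 : ℕ) : ℝ) + 1 := by exact_mod_cast this
        linarith
      have : ((n : ℝ) / 2) ^ 2 ≤ (((n / 2 : ℕ) : ℝ) + 1) ^ 2 := by gcongr
      linarith
    calc 1 + waveSq k = (1 + waveSq k) ^ (1 - s) * (1 + waveSq k) ^ s := by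
          rw [← Real.rpow_add hk]; simp
      _ ≤ (((n : ℝ) / 2) ^ 2) ^ (1 - s) * (1 + waveSq k) ^ s := by
          gcongr ?_ * _
          exact Real.rpow_le_rpow_of_nonpos (by positivity) h1 (by linarith)
      _ = _ := by
          rw [← Real.rpow_natCast, ← Real.rpow_mul hn'.le]; norm_num

/-! ### Interactions involving a high frequency -/

/-- The sum of `b_p b_{k-p}` over the pairs with a high frequency. -/
def highSum (N : ℕ) (a : Wave d → Amp d) (k : Wave d) : ℝ≥0∞ :=
  ∑' p, if p ∈ modes d N ∧ k - p ∈ modes d N then 0 else weighted a p * weighted a (k - p)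

/-- At least one factor of each pair lies in the tail. By symmetry this is at most twice one
convolution, whence `4 = 2²`, and Young puts the tail in `ℓ²`. -/
lemma tsum_highSum_sq_le (N : ℕ) (a : Wave d → Amp d) :
    ∑' k, highSum N a k ^ 2 ≤
      4 * ((∑' k, weighted a k) ^ 2 * ∑' k, tailWeighted N a k ^ 2) := by
  have h1 : ∀ k, highSum N a k ≤ 2 * ∑' p, weighted a p * tailWeighted N a (k - p) := by
    intro k
    have h2 : ∑' p, tailWeighted N a p * weighted a (k - p) =
        ∑' p, weighted a p * tailWeighted N a (k - p) := by
      rw [← (Equiv.subLeft k).tsum_eq fun p => weighted a p * tailWeighted N a (k - p)]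
      refine tsum_congr fun p => ?_
      simp [mul_comm]
    calc highSum N a k ≤ ∑' p, (tailWeighted N a p * weighted a (k - p) +
          weighted a p * tailWeighted N a (k - p)) := by
          refine ENNReal.tsum_le_tsum fun p => ?_
          unfold tailWeighted
          by_cases h3 : p ∈ modes d N <;> by_cases h4 : k - p ∈ modes d N <;> simp [h3, h4]
      _ = _ := by rw [ENNReal.tsum_add, h2, two_mul]
  calc ∑' k, highSum N a k ^ 2
      ≤ ∑' k, (2 * ∑' p, weighted a p * tailWeighted N a (k - p)) ^ 2 :=
        ENNReal.tsum_le_tsum fun k => by gcongr; exact h1 k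
    _ = 4 * ∑' k, (∑' p, weighted a p * tailWeighted N a (k - p)) ^ 2 := by
        simp only [mul_pow, ENNReal.tsum_mul_left]; norm_num
    _ ≤ _ := by gcongr; exact ennreal_young _ _

/-- Transversality gives `k·a_p = (k-p)·a_p`, so the weight can sit on the factors instead of the
output frequency. The `2` comes from `norm_proj_le`. -/
lemma enorm_interaction_term_le {a : Wave d → Amp d} (ha : ∀ k, waveDot k (a k) = 0)
    (k p : Wave d) : ‖(-Complex.I) • waveDot k (a p) • proj k (a (k - p))‖ₑ ≤
      2 * (weighted a p * weighted a (k - p)) := by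
  have h1 : waveDot k (a p) = waveDot (k - p) (a p) := by
    conv_lhs => rw [← sub_add_cancel k p, waveDot_add_left, ha p, add_zero]
  have h2 : 2 * (weighted a p * weighted a (k - p)) = ENNReal.ofReal
      (2 * (√(1 + waveSq p) * ‖a p‖ * (√(1 + waveSq (k - p)) * ‖a (k - p)‖))) := by
    rw [weighted, weighted, ← ENNReal.ofReal_mul (by positivity), ENNReal.ofReal_mul zero_le_two,
      ENNReal.ofReal_ofNat]
  rw [h2, ← ofReal_norm]
  refine ENNReal.ofReal_le_ofReal ?_
  rw [norm_smul, norm_smul, norm_neg, Complex.norm_I, one_mul, h1]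
  have h3 : √(waveSq (k - p)) ≤ √(1 + waveSq (k - p)) := by gcongr; linarith
  have h4 : 1 ≤ √(1 + waveSq p) := by rw [Real.one_le_sqrt]; linarith [waveSq_nonneg p]
  calc ‖waveDot (k - p) (a p)‖ * ‖proj k (a (k - p))‖
      ≤ (√(waveSq (k - p)) * ‖a p‖) * (2 * ‖a (k - p)‖) := by
        gcongr
        · exact norm_waveDot_le _ _
        · exact norm_proj_le _ _
    _ ≤ (√(1 + waveSq (k - p)) * (√(1 + waveSq p) * ‖a p‖)) * (2 * ‖a (k - p)‖) := by
        gcongr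
        exact le_mul_of_one_le_left (norm_nonneg _) h4
    _ = _ := by ring

/-- Written as a series over all `p`, the truncated interaction can be compared term by term with
the full Euler nonlinearity. -/
lemma hasSum_interaction (F : Finset (Wave d)) (a : Wave d → Amp d) (k : Wave d) :
    HasSum (fun p => if p ∈ F ∧ k - p ∈ F then
      (-Complex.I) • waveDot k (a p) • proj k (a (k - p)) else 0) (interaction F F a a k) := by
  have h : interaction F F a a k = ∑ p ∈ F, if p ∈ F ∧ k - p ∈ F then
      (-Complex.I) • waveDot k (a p) • proj k (a (k - p)) else 0 := by
    rw [interaction, Finset.smul_sum, Finset.sum_filter, Finset.sum_product]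
    refine Finset.sum_congr rfl fun p hp => ?_
    have : ∀ q, p + q = k ↔ q = k - p := fun q => by rw [eq_sub_iff_add_eq, add_comm]
    simp only [this, Finset.sum_ite_eq', hp, true_and]
  rw [h]
  exact hasSum_sum_of_ne_finset_zero fun p hp => by simp [hp]

lemma enorm_le_highSum {N : ℕ} {a : Wave d → Amp d} (ha : ∀ k, waveDot k (a k) = 0)
    {k : Wave d} {f : Wave d → Amp d} {X : Amp d} (hf : HasSum f X)
    (h : ∀ p, f p = 0 ∨ ¬(p ∈ modes d N ∧ k - p ∈ modes d N) ∧
      f p = (-Complex.I) • waveDot k (a p) • proj k (a (k - p))) :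
    ‖X‖ₑ ≤ 2 * highSum N a k := by
  rw [← hf.tsum_eq, highSum, ← ENNReal.tsum_mul_left]
  refine (enorm_tsum_le_tsum_enorm).trans (ENNReal.tsum_le_tsum fun p => ?_)
  rcases h p with h | ⟨h1, h2⟩
  · rw [h, enorm_zero]; exact zero_le
  · rw [if_neg h1, h2]
    exact enorm_interaction_term_le ha k p

lemma enorm_residual_le (n : ℕ) {a : Wave d → Amp d} (ha : ∀ k, waveDot k (a k) = 0)
    {k : Wave d} {D : Amp d} (hD : HasSum (fun q => (-Complex.I) • waveDot k (a q) •
      proj k (a (k - q))) D) :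
    ‖D - interaction (modes d n) (modes d n) a a k‖ₑ ≤ 2 * highSum (n / 2) a k := by
  refine enorm_le_highSum ha (hD.sub (hasSum_interaction (modes d n) a k)) fun p => ?_
  have hsub : modes d (n / 2) ⊆ modes d n := modes_subset (by omega)
  by_cases h : p ∈ modes d n ∧ k - p ∈ modes d n
  · left; simp [h]
  · right
    exact ⟨fun h' => h ⟨hsub h'.1, hsub h'.2⟩, by simp [h]⟩

/-- Two frequencies in the cube of half-width `n / 2` have their sum in `modes d n`; an output
outside it needs a high input. -/
lemma enorm_interaction_le {n : ℕ} {a : Wave d → Amp d} (ha : ∀ k, waveDot k (a k) = 0)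
    {k : Wave d} (hk : k ∉ modes d n) :
    ‖interaction (modes d n) (modes d n) a a k‖ₑ ≤ 2 * highSum (n / 2) a k := by
  refine enorm_le_highSum ha (hasSum_interaction (modes d n) a k) fun p => ?_
  by_cases h : p ∈ modes d n ∧ k - p ∈ modes d n
  · right
    refine ⟨fun h' => hk ?_, by simp [h]⟩
    rw [mem_modes] at h' ⊢
    rw [mem_modes] at h'
    intro i
    have h1 := h'.1 i
    have h2 := h'.2 i
    rw [Pi.sub_apply] at h2
    rw [abs_le] at *
    have : 2 * ((n / 2 : ℕ) : ℤ) ≤ n := by omega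
    constructor <;> linarith [h1.1, h1.2, h2.1, h2.2]
  · left; simp [h]

lemma sum_norm_sq_le_of_highSum {N : ℕ} {a X : Wave d → Amp d} (P : Finset (Wave d))
    (h : ∀ k ∈ P, ‖X k‖ₑ ≤ 2 * highSum N a k) {H : ℝ}
    (hH : 4 * ∑' k, highSum N a k ^ 2 ≤ ENNReal.ofReal (H ^ 2)) :
    ∑ k ∈ P, ‖X k‖ ^ 2 ≤ H ^ 2 := by
  have h1 : ENNReal.ofReal (∑ k ∈ P, ‖X k‖ ^ 2) = ∑ k ∈ P, ‖X k‖ₑ ^ 2 := by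
    rw [ENNReal.ofReal_sum_of_nonneg fun _ _ => by positivity]
    exact Finset.sum_congr rfl fun k _ => by rw [ENNReal.ofReal_pow (norm_nonneg _), ofReal_norm]
  rw [← ENNReal.ofReal_le_ofReal_iff (sq_nonneg _), h1]
  refine le_trans ?_ hH
  calc ∑ k ∈ P, ‖X k‖ₑ ^ 2 ≤ ∑ k ∈ P, (2 * highSum N a k) ^ 2 :=
        Finset.sum_le_sum fun k hk => by gcongr; exact h k hk
    _ ≤ ∑' k, (2 * highSum N a k) ^ 2 := ENNReal.sum_le_tsum P
    _ = 4 * ∑' k, highSum N a k ^ 2 := by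
        simp only [mul_pow, ENNReal.tsum_mul_left]; norm_num

/-! ### Convergence of the lattice sum -/

lemma ennreal_tsum_prod_eq_pow (f : ℤ → ℝ≥0∞) :
    ∀ d : ℕ, ∑' k : Fin d → ℤ, ∏ i, f (k i) = (∑' z, f z) ^ d
  | 0 => by
      rw [tsum_eq_single default fun k hk => absurd (Subsingleton.elim k default) hk]
      simp
  | d + 1 => by
      rw [← (Fin.consEquiv fun _ : Fin (d + 1) => ℤ).tsum_eq fun k => ∏ i, f (k i),
        ENNReal.tsum_prod']
      simp only [Fin.consEquiv_apply, Fin.prod_univ_succ, Fin.cons_zero, Fin.cons_succ,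
        ENNReal.tsum_mul_left, ennreal_tsum_prod_eq_pow f d, ENNReal.tsum_mul_right, pow_succ']

lemma summable_one_add_sq_rpow :
    Summable fun z : ℤ => (1 + (z : ℝ) ^ 2) ^ (-(2 / 3) : ℝ) := by
  have h1 := Real.summable_abs_int_rpow (b := 4 / 3) (by norm_num)
  have h2 : Summable fun z : ℤ => if z = 0 then (1 : ℝ) else 0 :=
    (hasSum_ite_eq (0 : ℤ) (1 : ℝ)).summable
  refine (h1.add h2).of_nonneg_of_le (fun _ => by positivity) fun z => ?_
  by_cases h : z = 0
  · subst h; simp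
  · have hz : 0 < |(z : ℝ)| := by positivity
    rw [if_neg h, add_zero]
    calc (1 + (z : ℝ) ^ 2) ^ (-(2 / 3) : ℝ) ≤ (|(z : ℝ)| ^ 2) ^ (-(2 / 3) : ℝ) := by
          refine Real.rpow_le_rpow_of_nonpos (by positivity) ?_ (by norm_num)
          rw [sq_abs]; linarith
      _ = |(z : ℝ)| ^ (-(4 / 3) : ℝ) := by
          rw [← Real.rpow_natCast, ← Real.rpow_mul hz.le]; norm_num

/-- Each `(1+k_i²)^{-2/3}` dominates `(1+|k|²)^{-2/3}`, and `2d/3 ≤ 2`, so the summand is below a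
product of one-dimensional terms decaying like `|z|^{-4/3}`. -/
lemma latticeSum_lt_top (hd : d ≤ 3) : latticeSum d < ∞ := by
  have h1 : ∀ k : Wave d, ENNReal.ofReal (((1 + waveSq k) ^ 2)⁻¹) ≤
      ∏ i, ENNReal.ofReal ((1 + (k i : ℝ) ^ 2) ^ (-(2 / 3) : ℝ)) := by
    intro k
    have hk := waveSq_nonneg k
    rw [← ENNReal.ofReal_prod_of_nonneg fun i _ => by positivity]
    refine ENNReal.ofReal_le_ofReal ?_
    have h2 : ∀ i ∈ Finset.univ, (1 + waveSq k) ^ (-(2 / 3) : ℝ) ≤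
        (1 + (k i : ℝ) ^ 2) ^ (-(2 / 3) : ℝ) := by
      intro i _
      refine Real.rpow_le_rpow_of_nonpos (by positivity) ?_ (by norm_num)
      gcongr
      exact Finset.single_le_sum (f := fun i => ((k i : ℤ) : ℝ) ^ 2)
        (fun _ _ => sq_nonneg _) (Finset.mem_univ i)
    refine le_trans ?_ (Finset.prod_le_prod (fun i _ => by positivity) h2)
    rw [Finset.prod_const, Finset.card_univ, Fintype.card_fin, ← Real.rpow_natCast,
      ← Real.rpow_natCast, ← Real.rpow_mul (by positivity), ← Real.rpow_neg (by positivity)]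
    refine Real.rpow_le_rpow_of_exponent_le (by linarith) ?_
    have : (d : ℝ) ≤ 3 := by exact_mod_cast hd
    push_cast
    linarith
  refine (ENNReal.tsum_le_tsum h1).trans_lt ?_
  rw [ennreal_tsum_prod_eq_pow (fun z => ENNReal.ofReal ((1 + (z : ℝ) ^ 2) ^ (-(2 / 3) : ℝ)))]
  refine ENNReal.pow_lt_top ?_
  rw [← ENNReal.ofReal_tsum_of_nonneg (fun _ => by positivity) summable_one_add_sq_rpow]
  exact ENNReal.ofReal_lt_top

/-! ### Gronwall and the resolved error -/

/-- The function `E e^{-Aτ} - Bτ` is nonincreasing, because `e^{-Aτ} ≤ 1`. Derivatives are needed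
only in the open interval. -/
lemma gronwall_of_deriv_le {T A B : ℝ} (hA : 0 ≤ A) (hB : 0 ≤ B) {E E' : ℝ → ℝ}
    (hE : ContinuousOn E (Icc 0 T)) (hE' : ∀ t ∈ Ioo 0 T, HasDerivAt E (E' t) t)
    (h : ∀ t ∈ Ioo 0 T, E' t ≤ A * E t + B) (h0 : E 0 = 0) {t : ℝ} (ht : t ∈ Icc 0 T) :
    E t ≤ B * T * Real.exp (A * T) := by
  have hd : ∀ τ ∈ Ioo 0 T, HasDerivAt (fun τ => E τ * Real.exp (-A * τ) - B * τ)
      (E' τ * Real.exp (-A * τ) + E τ * (Real.exp (-A * τ) * (-A * 1)) - B * 1) τ := fun τ hτ =>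
    ((hE' τ hτ).mul ((hasDerivAt_id τ).const_mul (-A)).exp).sub ((hasDerivAt_id τ).const_mul B)
  have hanti : AntitoneOn (fun τ => E τ * Real.exp (-A * τ) - B * τ) (Icc 0 T) := by
    refine antitoneOn_of_deriv_nonpos (convex_Icc 0 T) (by fun_prop) ?_ ?_
    · rw [interior_Icc]
      exact fun τ hτ => (hd τ hτ).differentiableAt.differentiableWithinAt
    · rw [interior_Icc]
      intro τ hτ
      rw [(hd τ hτ).deriv]
      have h1 : Real.exp (-A * τ) ≤ 1 := by
        rw [Real.exp_le_one_iff]; nlinarith [hτ.1]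
      have h2 := mul_le_mul_of_nonneg_right (h τ hτ) (Real.exp_pos (-A * τ)).le
      nlinarith [mul_le_mul_of_nonneg_left h1 hB]
  have h1 := hanti ⟨le_rfl, ht.1.trans ht.2⟩ ht ht.1
  simp only [h0, zero_mul, mul_zero, sub_zero] at h1
  have h2 : E t * Real.exp (-A * t) ≤ B * T := by
    nlinarith [mul_le_mul_of_nonneg_left ht.2 hB]
  calc E t = E t * Real.exp (-A * t) * Real.exp (A * t) := by
        rw [mul_assoc, ← Real.exp_add]; simp
    _ ≤ B * T * Real.exp (A * t) := by gcongr
    _ ≤ B * T * Real.exp (A * T) := by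
        have := ht.1.trans ht.2
        gcongr
        exact ht.2

lemma inner_real_eq_re (y z : Amp d) : inner ℝ y z = (inner ℂ y z).re := by
  simp [PiLp.inner_apply, Complex.inner]

lemma summable_norm_of_weighted {a : Wave d → Amp d} (h : ∑' k, weighted a k ≠ ∞) :
    Summable fun k => ‖a k‖ := by
  have h1 : ∑' k, ‖a k‖ₑ ≠ ∞ :=
    ne_top_of_le_ne_top h (ENNReal.tsum_le_tsum (enorm_le_weighted a))
  have h2 : Summable fun k => ‖a k‖₊ := ENNReal.tsum_coe_ne_top_iff_summable.1 h1
  exact NNReal.summable_coe.2 h2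

lemma reflect_fourierCoef {f : Space d → Space d} (hf : Continuous f) (k : Wave d) :
    reflect (fourierCoef f) k = fourierCoef f k := by
  ext j
  have h := scalarCoef_conj (fun x => ((f x j : ℝ) : ℂ)) k
  simp only [Complex.conj_ofReal] at h
  simp only [reflect, conjA]
  rw [fourierCoef_apply hf, fourierCoef_apply hf, ← h]

lemma sum_wave_le_of_weighted {a : Wave d → Amp d} {L : ℝ} (hL0 : 0 ≤ L)
    (hL : ∑' k, weighted a k ≤ ENNReal.ofReal L) (P : Finset (Wave d)) :
    ∑ q ∈ P, √(waveSq q) * ‖a q‖ ≤ L := by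
  rw [← ENNReal.ofReal_le_ofReal_iff hL0, ENNReal.ofReal_sum_of_nonneg fun _ _ => by positivity]
  refine le_trans (Finset.sum_le_sum fun q _ => ?_) ((ENNReal.sum_le_tsum P).trans hL)
  refine ENNReal.ofReal_le_ofReal ?_
  gcongr
  linarith

/-- The energy bound for the resolved modes of the error. -/
lemma resolved_error_le {T : ℝ} {u : ℝ → Space d → Space d} {p : ℝ → Space d → ℝ}
    (hu : IsEulerSolution T u p) {n m : ℕ} (hnm : n ≤ m) {v : ℝ → Wave d → Amp d}
    (hv : IsTModelSolution n m T (fourierCoef (u 0)) v) {L H : ℝ} (hL0 : 0 ≤ L) (hH0 : 0 ≤ H)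
    (hL : ∀ t ∈ Icc 0 T, ∑' k, weighted (fourierCoef (u t)) k ≤ ENNReal.ofReal L)
    (hH : ∀ t ∈ Icc 0 T, 4 * ∑' k, highSum (n / 2) (fourierCoef (u t)) k ^ 2 ≤
      ENNReal.ofReal (H ^ 2)) {t : ℝ} (ht : t ∈ Icc 0 T) :
    ∑ k ∈ modes d n, ‖fourierCoef (u t) k - v t k‖ ^ 2 ≤
      (T + 1) * H ^ 2 * T * Real.exp ((2 * (L + 2 * T * L ^ 2 + 1 / 2)) * T) := by
  have hT : 0 ≤ T := ht.1.trans ht.2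
  have h0 : (0 : ℝ) ∈ Icc 0 T := ⟨le_rfl, hT⟩
  have hD : ∀ t ∈ Ioo 0 T, ∃ D : Wave d → Amp d, ∀ k,
      HasDerivAt (fun τ => fourierCoef (u τ) k) (D k) t ∧
      HasSum (fun q => (-Complex.I) • waveDot k (fourierCoef (u t) q) •
        proj k (fourierCoef (u t) (k - q))) (D k) := by
    intro t ht
    have hs := summable_norm_of_weighted
      (ne_top_of_le_ne_top ENNReal.ofReal_ne_top (hL t (Ioo_subset_Icc_self ht)))
    choose D hD using fun k => hu.hasDerivAt_coef ht hs k
    exact ⟨D, hD⟩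
  choose! D hD using hD
  refine gronwall_of_deriv_le (E := fun t => ∑ k ∈ modes d n, ‖fourierCoef (u t) k - v t k‖ ^ 2)
    (E' := fun t => ∑ k ∈ modes d n, 2 * inner ℝ (fourierCoef (u t) k - v t k)
      (D t k - tModelField n m t (v t) k)) (by positivity) (by positivity) ?_ ?_ ?_ ?_ ht
  · refine continuousOn_finsetSum _ fun k hk => ContinuousOn.pow (ContinuousOn.norm ?_) 2
    exact (hu.continuousOn_coef k).sub fun τ hτ => (hv.hasDerivWithinAt hτ hk).continuousWithinAt
  · intro τ hτ
    refine HasDerivAt.fun_sum fun k hk => HasDerivAt.norm_sq ?_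
    exact (hD τ hτ k).1.sub ((hv.hasDerivWithinAt (Ioo_subset_Icc_self hτ) hk).hasDerivAt
      (Icc_mem_nhds hτ.1 hτ.2))
  · intro τ hτ
    have hτ' := Ioo_subset_Icc_self hτ
    have hdiv := hu.waveDot_coef hτ'
    have hdiv0 := hu.waveDot_coef h0
    have hreal := reflect_fourierCoef (hu.contDiff_slice hτ').continuous
    have hreal0 := reflect_fourierCoef (hu.contDiff_slice h0).continuous
    have hmain := energy_estimate hnm hτ.1.le (W := fourierCoef (u τ)) (V := v τ)
      -- The residual is the part of the Euler nonlinearity missed by truncation; it contains only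
      -- pairs with a frequency outside `modes d n`.
      (R := fun k => D τ k - interaction (modes d n) (modes d n) (fourierCoef (u τ))
        (fourierCoef (u τ)) k) (fun k _ => hdiv k) (fun k hk => hv.waveDot_eq_zero hdiv0 hτ' hk)
      (fun k _ => hreal k) (fun k hk => hv.reflect_eq hreal0 hτ' hk)
      (sum_wave_le_of_weighted hL0 (hL τ hτ') _) hH0
      (sum_norm_sq_le_of_highSum _ (fun k _ => enorm_residual_le n hdiv (hD τ hτ k).2) (hH τ hτ'))
      (sum_norm_sq_le_of_highSum _ (fun k hk => enorm_interaction_le hdiv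
        (Finset.mem_sdiff.1 hk).2) (hH τ hτ'))
    simp only [add_sub_cancel] at hmain
    simp only [inner_real_eq_re, ← Finset.mul_sum, ← Complex.re_sum]
    have hE0 : 0 ≤ ∑ k ∈ modes d n, ‖fourierCoef (u τ) k - v τ k‖ ^ 2 := by positivity
    have h1 : (L + 2 * τ * L ^ 2 + 1 / 2) * ∑ k ∈ modes d n, ‖fourierCoef (u τ) k - v τ k‖ ^ 2 ≤
        (L + 2 * T * L ^ 2 + 1 / 2) * ∑ k ∈ modes d n, ‖fourierCoef (u τ) k - v τ k‖ ^ 2 := by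
      gcongr
      exact hτ.2.le
    have h2 : (τ + 1) / 2 * H ^ 2 ≤ (T + 1) / 2 * H ^ 2 := by
      gcongr
      exact hτ.2.le
    linarith
  · refine Finset.sum_eq_zero fun k hk => ?_
    rw [hv.initial k hk, sub_self, norm_zero]
    norm_num

/-! ### The `L²` error through Parseval -/

lemma contDiff_exp_I_phase (k : Wave d) :
    ContDiff ℝ 1 fun x : Space d => Complex.exp (Complex.I * (phase k x : ℂ)) := by
  simpa [phase_neg] using contDiff_exp_phase (-k)

/-- Orthogonality from differentiation: the coefficient `c` satisfies `i k_j c = i l_j c` for a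
coordinate where `k` and `l` differ. -/
lemma scalarCoef_exp (l k : Wave d) :
    scalarCoef (fun x => Complex.exp (Complex.I * (phase l x : ℂ))) k = if k = l then 1 else 0 := by
  split_ifs with h
  · subst h
    have h1 : ∀ x : Space d, Complex.exp (-(Complex.I * (phase k x : ℂ))) *
        Complex.exp (Complex.I * (phase k x : ℂ)) = 1 := fun x => by
      rw [← Complex.exp_add, neg_add_cancel, Complex.exp_zero]
    have h2 : (2 * Real.pi) ^ d ≠ 0 := by positivity
    simp only [scalarCoef, h1]
    rw [setIntegral_cell]
    have h3 : (volume (Icc (0 : Fin d → ℝ) fun _ => 2 * Real.pi)).toReal = (2 * Real.pi) ^ d := by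
      rw [Real.volume_Icc_pi_toReal fun _ => by simp [Real.pi_pos.le]]
      simp
    rw [setIntegral_const, measureReal_def, h3, smul_smul, inv_mul_cancel₀ h2, one_smul]
  · obtain ⟨j, hj⟩ := Function.ne_iff.1 h
    have h1 := scalarCoef_fderiv (exp_phase_periodic l) (contDiff_exp_I_phase l) j k
    have h2 : ∀ x, fderiv ℝ (fun x : Space d => Complex.exp (Complex.I * (phase l x : ℂ))) x
        (EuclideanSpace.single j 1) = Complex.I * l j *
          Complex.exp (Complex.I * (phase l x : ℂ)) := by
      intro x
      simpa [phase_neg] using fderiv_exp_phase (-l) x j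
    simp only [h2, scalarCoef_const_mul] at h1
    have h3 : ((l j : ℂ) - k j) ≠ 0 := by
      rw [sub_ne_zero]; exact_mod_cast Ne.symm hj
    have h4 : Complex.I * ((l j : ℂ) - k j) *
        scalarCoef (fun x => Complex.exp (Complex.I * (phase l x : ℂ))) k = 0 := by
      linear_combination h1
    simpa [h3] using h4

lemma continuous_trigPoly (n : ℕ) (a : Wave d → Amp d) : Continuous (trigPoly n a) := by
  unfold trigPoly
  exact continuous_finsetSum _ fun k _ => (contDiff_exp_I_phase k).continuous.smul continuous_const

lemma trigPoly_apply (n : ℕ) (a : Wave d → Amp d) (x : Space d) (j : Fin d) :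
    trigPoly n a x j = ∑ k ∈ modes d n, a k j * Complex.exp (Complex.I * (phase k x : ℂ)) := by
  simp [trigPoly, Finset.sum_apply, mul_comm]

lemma scalarCoef_sub_trigPoly {f : Space d → Space d} (hf : Continuous f) (n : ℕ)
    (a : Wave d → Amp d) (k : Wave d) (j : Fin d) :
    scalarCoef (fun x => (toAmp (f x) - trigPoly n a x) j) k =
      (fourierCoef f k - cut (modes d n) a k) j := by
  have h1 : ∀ x, (toAmp (f x) - trigPoly n a x) j = ((f x j : ℝ) : ℂ) +
      ∑ l ∈ modes d n, -a l j * Complex.exp (Complex.I * (phase l x : ℂ)) := by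
    intro x
    rw [PiLp.sub_apply, trigPoly_apply]
    simp [toAmp, sub_eq_add_neg]
  have hc : ∀ l, Continuous fun x : Space d =>
      -a l j * Complex.exp (Complex.I * (phase l x : ℂ)) := fun l =>
    continuous_const.mul (contDiff_exp_I_phase l).continuous
  simp only [h1]
  rw [scalarCoef_add (continuous_coord hf j) (continuous_finsetSum _ fun l _ => hc l),
    scalarCoef_sum _ hc, PiLp.sub_apply, fourierCoef_apply hf, sub_eq_add_neg]
  congr 1
  simp only [scalarCoef_const_mul, scalarCoef_exp, mul_ite, mul_one, mul_zero, Finset.sum_ite_eq]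
  by_cases h : k ∈ modes d n
  · simp [h, cut_of_mem h]
  · simp [h, cut_of_notMem h]

/-- Parseval's identity for the difference of a field and a trigonometric polynomial. -/
lemma l2Norm_sub_trigPoly {f : Space d → Space d} (hp : IsPeriodic f) (hf : Continuous f)
    (hs : Summable fun k => ‖fourierCoef f k‖) (n : ℕ) (a : Wave d → Amp d) :
    ∃ S : ℝ, HasSum (fun k => ‖fourierCoef f k - cut (modes d n) a k‖ ^ 2) S ∧
      l2Norm (fun x => toAmp (f x) - trigPoly n a x) =
        ENNReal.ofReal √((2 * Real.pi) ^ d * S) := by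
  set w : Space d → Amp d := fun x => toAmp (f x) - trigPoly n a x with hw
  have hwc : Continuous w := (continuous_toAmp.comp hf).sub (continuous_trigPoly n a)
  have hwp : IsPeriodic w := by
    intro x j
    have h := fun k : Wave d => exp_phase_periodic k x j
    simp only [hw, hp x j, trigPoly, h]
  have hcs : Summable fun k => ‖fourierCoef f k - cut (modes d n) a k‖ := by
    refine (hs.add (g := fun k => ‖cut (modes d n) a k‖) ?_).of_nonneg_of_le
      (fun _ => norm_nonneg _) fun k => norm_sub_le _ _
    refine summable_of_ne_finset_zero (s := modes d n) fun k hk => ?_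
    rw [cut_of_notMem hk, norm_zero]
  have hj : ∀ j, HasSum (fun k => ‖(fourierCoef f k - cut (modes d n) a k) j‖ ^ 2)
      (((2 * Real.pi) ^ d)⁻¹ * ∫ x in cell d, ‖w x j‖ ^ 2) := by
    intro j
    have h1 : ∀ k, scalarCoef (fun x => w x j) k =
        (fourierCoef f k - cut (modes d n) a k) j := fun k => scalarCoef_sub_trigPoly hf n a k j
    have h2 := hasSum_norm_sq_scalarCoef (f := fun x => w x j)
      (fun x l => by simp only [hwp x l]) (by fun_prop) ?_
    · simpa only [h1] using h2
    · simp only [h1]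
      exact hcs.of_nonneg_of_le (fun _ => norm_nonneg _) fun k => norm_coord_le _ _
  have hsum := hasSum_sum (s := Finset.univ) fun j _ => hj j
  simp only [← EuclideanSpace.norm_sq_eq] at hsum
  refine ⟨_, hsum, ?_⟩
  have hpos : (2 * Real.pi) ^ d ≠ 0 := by positivity
  rw [← Finset.mul_sum, mul_inv_cancel_left₀ hpos, ← integral_finsetSum]
  · simp only [← EuclideanSpace.norm_sq_eq]
    have hmem : MemLp w 2 (volume.restrict (cell d)) := by
      rw [memLp_two_iff_integrable_sq_norm hwc.aestronglyMeasurable]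
      exact Continuous.integrable_cell (by fun_prop)
    rw [l2Norm, hmem.eLpNorm_eq_integral_rpow_norm two_ne_zero ENNReal.ofNat_ne_top,
      Real.sqrt_eq_rpow]
    simp
  · intro j _
    exact Continuous.integrable_cell (by fun_prop)

/-! ### Sobolev constants and the final bound -/

lemma sobolevNorm_eq (s : ℝ) (f : Space d → Space d) :
    sobolevNorm s f = (ENNReal.ofReal ((2 * Real.pi) ^ d) *
      sobolevSum s (fourierCoef f)) ^ (1 / 2 : ℝ) := rfl

lemma sobolevSum_le {s : ℝ} {f : Space d → Space d} {K : ℝ≥0∞} (h : sobolevNorm s f ≤ K) :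
    sobolevSum s (fourierCoef f) ≤ K ^ 2 := by
  rw [sobolevNorm_eq] at h
  have h1 : 1 ≤ ENNReal.ofReal ((2 * Real.pi) ^ d) := by
    rw [ENNReal.one_le_ofReal]
    exact one_le_pow₀ (by linarith [Real.pi_gt_three])
  calc sobolevSum s (fourierCoef f)
      ≤ ENNReal.ofReal ((2 * Real.pi) ^ d) * sobolevSum s (fourierCoef f) :=
        le_mul_of_one_le_left zero_le h1
    _ = ((ENNReal.ofReal ((2 * Real.pi) ^ d) *
          sobolevSum s (fourierCoef f)) ^ (1 / 2 : ℝ)) ^ 2 := (ennreal_sqrt_sq _).symm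
    _ ≤ K ^ 2 := by gcongr

/-- The constant of the embedding of `H³` into the fields with summable weighted amplitudes. -/
def embeddingBound (d : ℕ) (M : ℝ) : ℝ := √((latticeSum d).toReal) * max M 0

lemma embeddingBound_nonneg (d : ℕ) (M : ℝ) : 0 ≤ embeddingBound d M := by
  unfold embeddingBound; positivity

lemma tsum_weighted_le (hd : d ≤ 3) {M : ℝ} {f : Space d → Space d}
    (h : sobolevNorm 3 f ≤ ENNReal.ofReal M) :
    ∑' k, weighted (fourierCoef f) k ≤ ENNReal.ofReal (embeddingBound d M) := by
  have h1 := (tsum_weighted_sq_le (fourierCoef f)).trans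
    (mul_le_mul_right (sobolevSum_le h) _)
  -- For negative `M`, `ENNReal.ofReal M` is zero, in agreement with the `max M 0` in
  -- `embeddingBound`.
  have h2 : latticeSum d * ENNReal.ofReal M ^ 2 = ENNReal.ofReal (embeddingBound d M) ^ 2 := by
    rw [embeddingBound, ENNReal.ofReal_mul (Real.sqrt_nonneg _), mul_pow,
      ← ENNReal.ofReal_pow (Real.sqrt_nonneg _), Real.sq_sqrt ENNReal.toReal_nonneg,
      ENNReal.ofReal_toReal (latticeSum_lt_top hd).ne]
    congr 2
    simp [ENNReal.ofReal_max]
  rw [h2] at h1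
  exact (ENNReal.pow_le_pow_left_iff two_ne_zero).1 h1

/-- The sum of the squared error amplitudes. -/
lemma error_sum_le {n : ℕ} {a v : Wave d → Amp d} {S E θ : ℝ} (hE : 0 ≤ E)
    (hS : HasSum (fun k => ‖a k - cut (modes d n) v k‖ ^ 2) S)
    (hF : ∑ k ∈ modes d n, ‖a k - v k‖ ^ 2 ≤ E)
    (hθ : ∑' k, tailWeighted (n / 2) a k ^ 2 ≤ ENNReal.ofReal θ) (hθ0 : 0 ≤ θ) :
    S ≤ E + θ := by
  rw [← ENNReal.ofReal_le_ofReal_iff (by positivity), ← hS.tsum_eq,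
    ENNReal.ofReal_tsum_of_nonneg (fun _ => by positivity) hS.summable, ENNReal.ofReal_add hE hθ0]
  have h1 : ∀ k, ENNReal.ofReal (‖a k - cut (modes d n) v k‖ ^ 2) ≤
      (if k ∈ modes d n then ENNReal.ofReal (‖a k - v k‖ ^ 2) else 0) +
        tailWeighted (n / 2) a k ^ 2 := by
    intro k
    by_cases hk : k ∈ modes d n
    · rw [if_pos hk, cut_of_mem hk]; exact le_self_add
    -- Outside `F` the error is `u_k` itself; the tail beyond `n / 2`, already estimated, covers it.
    · have hk' : k ∉ modes d (n / 2) := fun h => hk (modes_subset (by omega) h)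
      rw [if_neg hk, cut_of_notMem hk, sub_zero, zero_add, tailWeighted, if_neg hk',
        ENNReal.ofReal_pow (norm_nonneg _), ofReal_norm]
      gcongr
      exact enorm_le_weighted a k
  refine (ENNReal.tsum_le_tsum h1).trans ?_
  rw [ENNReal.tsum_add]
  refine add_le_add ?_ hθ
  rw [tsum_eq_sum (s := modes d n) fun k hk => if_neg hk]
  refine le_trans (le_of_eq ?_) (ENNReal.ofReal_le_ofReal hF)
  rw [ENNReal.ofReal_sum_of_nonneg fun _ _ => by positivity]
  exact Finset.sum_congr rfl fun k hk => if_pos hk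

/-- The constant of the error bound, before normalization. -/
def errorConst (d : ℕ) (T M : ℝ) : ℝ :=
  (T + 1) * (16 * embeddingBound d M ^ 2) * T * Real.exp
    ((2 * (embeddingBound d M + 2 * T * embeddingBound d M ^ 2 + 1 / 2)) * T) + 1

lemma errorConst_pos (d : ℕ) {T : ℝ} (hT : 0 < T) (M : ℝ) : 0 < errorConst d T M := by
  have := embeddingBound_nonneg d M
  unfold errorConst
  positivity

/-- With `r = (n/2)^{1-s}` the tail is at most `r²K²`, and the two factors `4` from
`enorm_le_highSum` and `tsum_highSum_sq_le` give `H = 4LrK`. In `errorConst` this yields `16 L²`,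
while the final `+ 1` accounts for the modes outside `F`. -/
lemma l2Norm_error_le (hd : d ≤ 3) {s : ℝ} (hs : 1 ≤ s) {T : ℝ} {M : ℝ}
    {u : ℝ → Space d → Space d} {p : ℝ → Space d → ℝ} (hu : IsEulerSolution T u p)
    (hM : ∀ t ∈ Icc 0 T, sobolevNorm 3 (u t) ≤ ENNReal.ofReal M) {n m : ℕ} (hn : 1 ≤ n)
    (hnm : n ≤ m) {v : ℝ → Wave d → Amp d} (hv : IsTModelSolution n m T (fourierCoef (u 0)) v)
    {K : ℝ} (hK0 : 0 ≤ K) (hK : ∀ t ∈ Icc 0 T, sobolevNorm s (u t) ≤ ENNReal.ofReal K)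
    {t : ℝ} (ht : t ∈ Icc 0 T) :
    l2Norm (fun x => toAmp (u t x) - trigPoly n (v t) x) ≤
      ENNReal.ofReal (√((2 * Real.pi) ^ d * errorConst d T M) *
        (((n : ℝ) / 2) ^ (1 - s)) * K) := by
  set L := embeddingBound d M with hLdef
  have hL0 : 0 ≤ L := embeddingBound_nonneg d M
  have hT : 0 ≤ T := ht.1.trans ht.2
  have hn0 : (0 : ℝ) < (n : ℝ) / 2 := by positivity
  set r := ((n : ℝ) / 2) ^ (1 - s) with hr
  have hr0 : 0 ≤ r := by positivity
  have hr2 : ((n : ℝ) / 2) ^ (2 * (1 - s)) = r ^ 2 := by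
    rw [hr, ← Real.rpow_natCast, ← Real.rpow_mul hn0.le, mul_comm]; norm_num
  have hL : ∀ t ∈ Icc 0 T, ∑' k, weighted (fourierCoef (u t)) k ≤ ENNReal.ofReal L :=
    fun t ht => tsum_weighted_le hd (hM t ht)
  have htail : ∀ t ∈ Icc 0 T, ∑' k, tailWeighted (n / 2) (fourierCoef (u t)) k ^ 2 ≤
      ENNReal.ofReal (r ^ 2 * K ^ 2) := by
    intro t ht
    refine (tsum_tailWeighted_sq_le hn hs _).trans ?_
    rw [hr2, ENNReal.ofReal_mul (sq_nonneg _), ENNReal.ofReal_pow hK0]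
    gcongr
    exact sobolevSum_le (hK t ht)
  have hH : ∀ t ∈ Icc 0 T, 4 * ∑' k, highSum (n / 2) (fourierCoef (u t)) k ^ 2 ≤
      ENNReal.ofReal ((4 * L * r * K) ^ 2) := by
    intro t ht
    have e : ENNReal.ofReal ((4 * L * r * K) ^ 2) =
        4 * (4 * (ENNReal.ofReal L ^ 2 * ENNReal.ofReal (r ^ 2 * K ^ 2))) := by
      rw [← ENNReal.ofReal_pow hL0, ← ENNReal.ofReal_mul (sq_nonneg _),
        ← ENNReal.ofReal_ofNat 4, ← ENNReal.ofReal_mul (by norm_num),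
        ← ENNReal.ofReal_mul (by norm_num)]
      congr 1; ring
    rw [e]
    gcongr
    refine (tsum_highSum_sq_le _ _).trans ?_
    gcongr
    · exact hL t ht
    · exact htail t ht
  have hres := resolved_error_le hu hnm hv hL0 (by positivity : 0 ≤ 4 * L * r * K) hL hH ht
  have hsum := summable_norm_of_weighted (ne_top_of_le_ne_top ENNReal.ofReal_ne_top (hL t ht))
  obtain ⟨S, hS, hl2⟩ := l2Norm_sub_trigPoly (hu.periodic t ht) (hu.contDiff_slice ht).continuous
    hsum n (v t)
  have hSle := error_sum_le (by positivity) hS hres (htail t ht) (by positivity)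
  rw [hl2]
  refine ENNReal.ofReal_le_ofReal (Real.sqrt_le_iff.2 ⟨by positivity, ?_⟩)
  have hpi : 0 ≤ (2 * Real.pi) ^ d := by positivity
  have hEC : 0 ≤ errorConst d T M := by unfold errorConst; positivity
  rw [mul_pow (_ * _), mul_pow √_, Real.sq_sqrt (mul_nonneg hpi hEC), mul_assoc, mul_assoc]
  refine mul_le_mul_of_nonneg_left (hSle.trans (le_of_eq ?_)) hpi
  rw [errorConst, ← hLdef]
  ring

end

end TModelEuler

theorem mainTheorem2 (d : ℕ) (hd : d = 2 ∨ d = 3) (s : ℝ) (hs : 3 ≤ s) (T : ℝ) (hT : 0 < T)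
    (M : ℝ) :
    ∃ C : ℝ, ∀ (u : ℝ → TModelEuler.Space d → TModelEuler.Space d)
      (p : ℝ → TModelEuler.Space d → ℝ),
      TModelEuler.IsEulerSolution T u p →
      (∀ t ∈ Set.Icc 0 T, TModelEuler.MemSobolev s (u t)) →
      (∀ t ∈ Set.Icc 0 T, TModelEuler.sobolevNorm 3 (u t) ≤ ENNReal.ofReal M) →
      ∀ (n m : ℕ), 1 ≤ n → n ≤ m →
      ∀ v : ℝ → TModelEuler.Wave d → TModelEuler.Amp d,
      TModelEuler.IsTModelSolution n m T (TModelEuler.fourierCoef (u 0)) v →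
      ∀ t ∈ Set.Icc 0 T,
        TModelEuler.l2Norm
            (fun x => TModelEuler.toAmp (u t x) - TModelEuler.trigPoly n (v t) x) ≤
          ENNReal.ofReal (C / (n : ℝ) ^ (s - 1)) *
            ⨆ τ ∈ Set.Icc 0 T, TModelEuler.sobolevNorm s (u τ) := by
  have hd3 : d ≤ 3 := by omega
  have hEC := TModelEuler.errorConst_pos d hT M
  -- The factor `2^{s-1}` converts `(n/2)^{1-s}` into `n^{1-s}`.
  refine ⟨√((2 * Real.pi) ^ d * TModelEuler.errorConst d T M) * 2 ^ (s - 1), ?_⟩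
  intro u p hu _ hM n m hn hnm v hv t ht
  have hn0 : (0 : ℝ) < n := by exact_mod_cast hn
  set K := ⨆ τ ∈ Set.Icc 0 T, TModelEuler.sobolevNorm s (u τ) with hK
  have hKle : ∀ τ ∈ Set.Icc 0 T, TModelEuler.sobolevNorm s (u τ) ≤ K := fun τ hτ =>
    le_iSup₂_of_le τ hτ le_rfl
  -- Finiteness at each time does not by itself bound the supremum; if it is infinite, so is the
  -- right-hand side, as its constant is strictly positive.
  by_cases htop : K = ∞
  · rw [htop, ENNReal.mul_top]
    · exact le_top
    · rw [Ne, ENNReal.ofReal_eq_zero, not_le]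
      positivity
  · have h := TModelEuler.l2Norm_error_le hd3 (by linarith : 1 ≤ s) hu hM hn hnm hv
      ENNReal.toReal_nonneg (fun τ hτ => by rw [ENNReal.ofReal_toReal htop]; exact hKle τ hτ) ht
    refine h.trans (le_of_eq ?_)
    rw [ENNReal.ofReal_mul (by positivity), ENNReal.ofReal_toReal htop]
    congr 2
    rw [Real.div_rpow hn0.le zero_le_two, mul_div_assoc]
    congr 1
    have e : 1 - s = -(s - 1) := by ring
    rw [e, Real.rpow_neg hn0.le, Real.rpow_neg zero_le_two]
    field_simp
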